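/- Let $T^3=(\mathbb R/2\pi\mathbb Z)^3$ carry the flat metric and the measure $dx$ of total mass $8\pi^3$, let $\Delta f=-\sum_{k=1}^3\partial^2 f/\partial x_k^2$, and let $(f*g)(x)=\int_{T^3}f(y)\,g(x-y)\,dy$. A fundamental solution of the scalar Laplacian on $T^3$ is an integrable function $\varphi$ on $T^3$ such that $\int_{T^3}\varphi\,dx=0$ and, for every $f\in C^\infty(T^3)$ with $\int_{T^3}f\,dx=0$, the function $\varphi*f$ is $C^\infty$ and $\Delta(\varphi*f)=f$. Proposition. The fundamental solution of the scalar Laplacian on $T^3$ exists, is unique up to equality almost everywhere, and is given by the Fourier series $$\varphi(x)=\frac1{8\pi^3}\sum_{n\in\mathbb Z^3,\ n\neq0}\frac{e^{in\cdot x}}{\|n\|^2},$$ which converges unconditionally in $L^2(T^3)$. After a change on a null set, $\varphi$ is a real-valued function that is $C^\infty$ at every point $x\neq0$ of $T^3$. At $0$ it becomes infinite: $\varphi(x)\to+\infty$ as $x\to0$, $x\ne0$, and the series itself diverges to $+\infty$ at $x=0$. -/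

import Mathlib

open MeasureTheory Filter Topology
open scoped ContDiff Laplacian Convolution

instance factZeroLtTwoPi : Fact ((0 : ℝ) < 2 * Real.pi) := ⟨Real.two_pi_pos⟩

/-- The flat torus `T³ = (ℝ / 2πℤ)³`. Its `volume` is the product of the arc-length measures on the
circles `ℝ / 2πℤ`, so that its total volume is `8π³`. -/
abbrev Torus3 : Type := Fin 3 → AddCircle (2 * Real.pi)

/-- The covering projection `ℝ³ → T³`. -/
noncomputable def torusProj (v : EuclideanSpace ℝ (Fin 3)) : Torus3 :=
  fun i => ((v i : ℝ) : AddCircle (2 * Real.pi))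

/-- `f` is `C^∞` at the point `x` of the torus: it is so in the flat chart `v ↦ x + v mod 2π`
centred at `x`. -/
def TorusSmoothAt {F : Type*} [NormedAddCommGroup F] [NormedSpace ℝ F]
    (f : Torus3 → F) (x : Torus3) : Prop :=
  ContDiffAt ℝ ∞ (fun v : EuclideanSpace ℝ (Fin 3) => f (x + torusProj v)) 0

/-- `f ∈ C^∞(T³)`. -/
def TorusSmooth {F : Type*} [NormedAddCommGroup F] [NormedSpace ℝ F] (f : Torus3 → F) : Prop :=
  ∀ x, TorusSmoothAt f x

/-- The scalar Laplacian on the torus, with the geometers' sign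
`-(∂²/∂x₁² + ∂²/∂x₂² + ∂²/∂x₃²)`, computed in the flat chart centred at the point. -/
noncomputable def torusLaplacian (f : Torus3 → ℂ) (x : Torus3) : ℂ :=
  -(Δ (fun v : EuclideanSpace ℝ (Fin 3) => f (x + torusProj v))) 0

/-- The convolution `(f * g)(x) = ∫_{T³} f(y) g(x - y) dy`. -/
noncomputable def torusConv (f g : Torus3 → ℂ) : Torus3 → ℂ :=
  f ⋆[ContinuousLinearMap.mul ℝ ℂ, volume] g

theorem torusConv_apply (f g : Torus3 → ℂ) (x : Torus3) :
    torusConv f g x = ∫ y, f y * g (x - y) := rfl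

/-- `φ` is a fundamental solution of the scalar Laplacian on `T³`: an integrable function of mean
zero such that `φ * f` is smooth and `Δ (φ * f) = f` for all smooth `f` of mean zero. -/
structure IsTorusFundamentalSolution (φ : Torus3 → ℂ) : Prop where
  integrable : Integrable φ volume
  integral_eq_zero : ∫ x, φ x = 0
  smooth_conv : ∀ f : Torus3 → ℂ, TorusSmooth f → ∫ x, f x = 0 → TorusSmooth (torusConv φ f)
  laplacian_conv : ∀ f : Torus3 → ℂ, TorusSmooth f → ∫ x, f x = 0 →
    ∀ x, torusLaplacian (torusConv φ f) x = f x

/-- The character `x ↦ e^{i n·x}` of the torus. -/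
noncomputable def torusChar (n : Fin 3 → ℤ) (x : Torus3) : ℂ :=
  ∏ i, fourier (n i) (x i)

theorem torusChar_torusProj (n : Fin 3 → ℤ) (v : EuclideanSpace ℝ (Fin 3)) :
    torusChar n (torusProj v) = Complex.exp (Complex.I * ∑ i, (n i : ℂ) * (v i : ℂ)) := by
  have hpi : (Real.pi : ℂ) ≠ 0 := Complex.ofReal_ne_zero.mpr Real.pi_ne_zero
  unfold torusChar torusProj
  rw [Finset.mul_sum, Complex.exp_sum]
  refine Finset.prod_congr rfl fun i _ => ?_
  rw [fourier_coe_apply]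
  congr 1
  push_cast
  field_simp

/-- The partial sum over `s` of the series `(1 / 8π³) ∑_{n ≠ 0} e^{i n·x} / ‖n‖²`. -/
noncomputable def torusGreenPartialSum (s : Finset {n : Fin 3 → ℤ // n ≠ 0}) (x : Torus3) : ℂ :=
  (1 / (8 * (Real.pi : ℂ) ^ 3)) * ∑ n ∈ s, torusChar n.1 x / (∑ i, (n.1 i : ℂ) ^ 2)

/-!
# The Green function of the flat three-dimensional torus

In terms of the Fourier coefficients `torusCoeff f n = ∫ f(x) e^{-i n·x} dx`, the Laplacian
`torusLaplacian` multiplies by `‖n‖²` (`torusCoeff_torusLaplacian`) and convolution with `φ`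
multiplies by `torusCoeff φ n`.
Smooth functions have rapidly decaying coefficients and rapidly decaying coefficients sum to smooth
functions (`TorusSmooth.rapidDecay`, `RapidDecay.torusSmooth`). Hence an integrable `φ` is a
fundamental solution exactly when its coefficients are `‖n‖⁻²` for `n ≠ 0` and `0` for `n = 0`
(`isTorusFundamentalSolution_of_torusCoeff`, `IsTorusFundamentalSolution.torusCoeff_eq`). Since an
integrable function is determined almost everywhere by its coefficients
(`ae_eq_zero_of_torusCoeff_eq_zero`), this gives uniqueness, and the `L²` expansion of any
square-integrable solution is the series of the statement.

For existence and for the behaviour at `0`, such a function is built by hand. Let `P` be the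
Newtonian potential `1 / ‖v‖` cut off near the origin and transplanted to the torus. Then
`-ΔP = κ δ₀ - E`, where `Δ` is the sum of the second derivatives, with a constant `κ > 0` and
a smooth function `E`, which comes from differentiating the cutoff. On the level of coefficients
this is `torusEigenvalue_mul_torusCoeff_parametrix`. It is proved by regularising `1 / ‖v‖` to
`(‖v‖² + δ)^{-1/2}`, for which the equation is a computation, and letting `δ → 0`: away from the
shell where the cutoff varies, `-Δ` of the regularised potential is a rescaled bump whose mass
tends to `κ`.
The coefficients of `E` decay rapidly, so `P` differs from `κ` times the required function by a
smooth function. The Green function `torusGreen` therefore is in `L²`, is smooth away from `0`, and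
tends to `+∞` at `0`, because `P` does.

Finally, if `∑ ‖n‖⁻²` were finite, the Fourier series would converge to a continuous function that
agrees with the Green function almost everywhere, against the blow-up at `0`
(`not_summable_torusEigenvalue_inv`).
-/

/-! ### Characters of the torus -/

section Characters

theorem torusChar_zero (x : Torus3) : torusChar 0 x = 1 := by simp [torusChar]

theorem torusChar_apply_zero (n : Fin 3 → ℤ) : torusChar n 0 = 1 := by simp [torusChar]

theorem torusChar_add (m n : Fin 3 → ℤ) (x : Torus3) :
    torusChar (m + n) x = torusChar m x * torusChar n x := by
  simp only [torusChar, Pi.add_apply, fourier_add, Finset.prod_mul_distrib]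

theorem torusChar_apply_add (n : Fin 3 → ℤ) (x y : Torus3) :
    torusChar n (x + y) = torusChar n x * torusChar n y := by
  simp only [torusChar, Pi.add_apply, fourier_apply, smul_add,
    AddCircle.toCircle_add, Circle.coe_mul, Finset.prod_mul_distrib]

theorem torusChar_neg (n : Fin 3 → ℤ) (x : Torus3) :
    torusChar (-n) x = (starRingEnd ℂ) (torusChar n x) := by
  simp only [torusChar, Pi.neg_apply, fourier_neg, map_prod]

theorem torusChar_apply_neg (n : Fin 3 → ℤ) (x : Torus3) :
    torusChar n (-x) = torusChar (-n) x := by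
  simp [torusChar, fourier_apply]

theorem norm_torusChar (n : Fin 3 → ℤ) (x : Torus3) : ‖torusChar n x‖ = 1 := by
  simp only [torusChar, fourier_apply, norm_prod, Circle.norm_coe, Finset.prod_const_one]

theorem continuous_torusChar (n : Fin 3 → ℤ) : Continuous (torusChar n) := by
  unfold torusChar
  fun_prop

/-- The character `e^{i n·x}` as a continuous function. -/
noncomputable def torusCharC (n : Fin 3 → ℤ) : C(Torus3, ℂ) := ⟨torusChar n, continuous_torusChar n⟩

@[simp] theorem torusCharC_apply (n : Fin 3 → ℤ) (x : Torus3) :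
    torusCharC n x = torusChar n x := rfl

theorem volume_real_torus : (volume : Measure Torus3).real Set.univ = 8 * Real.pi ^ 3 := by
  rw [Measure.real, volume_pi, Measure.pi_univ]
  simp only [AddCircle.measure_univ, Finset.prod_const, Finset.card_univ, Fintype.card_fin]
  rw [ENNReal.toReal_pow, ENNReal.toReal_ofReal Real.two_pi_pos.le]
  ring

theorem integral_fourier_ne_zero {k : ℤ} (hk : k ≠ 0) :
    ∫ x : AddCircle (2 * Real.pi), fourier k x = 0 := by
  have h := integral_add_right_eq_self (μ := (volume : Measure (AddCircle (2 * Real.pi))))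
    (fun x => (fourier k x : ℂ)) ((2 * Real.pi / 2 / k : ℝ) : AddCircle (2 * Real.pi))
  simp_rw [fourier_add_half_inv_index hk Real.two_pi_pos, integral_neg] at h
  exact self_eq_neg.mp h.symm

theorem integral_torusChar (n : Fin 3 → ℤ) :
    ∫ x, torusChar n x = if n = 0 then 8 * (Real.pi : ℂ) ^ 3 else 0 := by
  split_ifs with h
  · simp only [h, torusChar_zero, integral_const, volume_real_torus]
    simp
  · unfold torusChar
    rw [MeasureTheory.integral_fintype_prod_volume_eq_prod (𝕜 := ℂ)
      (fun i (y : AddCircle (2 * Real.pi)) => (fourier (n i) y : ℂ))]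
    obtain ⟨i, hi⟩ := Function.ne_iff.mp h
    exact Finset.prod_eq_zero (Finset.mem_univ i) (integral_fourier_ne_zero hi)

theorem integrable_mul_torusChar {f : Torus3 → ℂ} (hf : Integrable f) (n : Fin 3 → ℤ) :
    Integrable fun x => f x * torusChar n x :=
  hf.mul_bdd (c := 1) (continuous_torusChar n).aestronglyMeasurable
    (Eventually.of_forall fun x => (norm_torusChar n x).le)

end Characters

/-! ### Density of trigonometric polynomials -/

section Density

theorem torusChar_single (i : Fin 3) (x : Torus3) :
    torusChar (Pi.single i 1) x = fourier 1 (x i) := by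
  unfold torusChar
  rw [Finset.prod_eq_single i]
  · simp
  · intro j _ hj
    simp [Pi.single_eq_of_ne hj]
  · simp

/-- The star subalgebra of `C(T³, ℂ)` generated by the characters. -/
noncomputable def torusCharSubalgebra : StarSubalgebra ℂ C(Torus3, ℂ) where
  toSubalgebra := Algebra.adjoin ℂ (Set.range torusCharC)
  star_mem' := by
    change Algebra.adjoin ℂ (Set.range torusCharC) ≤ star (Algebra.adjoin ℂ (Set.range torusCharC))
    refine Algebra.adjoin_le ?_
    rintro _ ⟨n, rfl⟩
    refine Algebra.subset_adjoin ⟨-n, ?_⟩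
    ext1 x
    simp [torusChar_neg]

theorem torusCharSubalgebra_coe :
    torusCharSubalgebra.toSubalgebra.toSubmodule = Submodule.span ℂ (Set.range torusCharC) := by
  apply Algebra.adjoin_eq_span_of_subset
  refine .trans (fun x ↦ Submonoid.closure_induction (fun _ ↦ id) ⟨0, ?_⟩ ?_) Submodule.subset_span
  · ext z
    simp [torusChar_zero]
  · rintro _ _ _ _ ⟨m, rfl⟩ ⟨n, rfl⟩
    refine ⟨m + n, ?_⟩
    ext z
    simp [torusChar_add]

/-- Trigonometric polynomials are uniformly dense, by the Stone–Weierstrass theorem. -/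
theorem span_torusCharC_closure_eq_top :
    (Submodule.span ℂ (Set.range torusCharC)).topologicalClosure = ⊤ := by
  have hsep : torusCharSubalgebra.SeparatesPoints := by
    intro x y hxy
    obtain ⟨i, hi⟩ := Function.ne_iff.mp hxy
    refine ⟨_, ⟨torusCharC (Pi.single i 1), Algebra.subset_adjoin ⟨Pi.single i 1, rfl⟩, rfl⟩, ?_⟩
    simp only [torusCharC_apply, torusChar_single, fourier_one, ne_eq]
    exact fun h => hi (AddCircle.injective_toCircle Real.two_pi_pos.ne' (Subtype.coe_injective h))
  rw [← torusCharSubalgebra_coe]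
  exact congr_arg (Subalgebra.toSubmodule <| StarSubalgebra.toSubalgebra ·)
    (ContinuousMap.starSubalgebra_topologicalClosure_eq_top_of_separatesPoints _ hsep)

end Density

/-! ### Fourier coefficients and uniqueness -/

section Coefficients

/-- The Fourier coefficient `∫ f(x) e^{-i n·x} dx`, not normalised by the volume `8π³`. -/
noncomputable def torusCoeff (f : Torus3 → ℂ) (n : Fin 3 → ℤ) : ℂ := ∫ x, f x * torusChar (-n) x

theorem torusCoeff_zero (f : Torus3 → ℂ) : torusCoeff f 0 = ∫ x, f x := by
  simp [torusCoeff, torusChar_zero]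

theorem torusCoeff_add {f g : Torus3 → ℂ} (hf : Integrable f) (hg : Integrable g)
    (n : Fin 3 → ℤ) : torusCoeff (fun x => f x + g x) n = torusCoeff f n + torusCoeff g n := by
  simp only [torusCoeff, add_mul]
  exact integral_add (integrable_mul_torusChar hf _) (integrable_mul_torusChar hg _)

theorem torusCoeff_sub {f g : Torus3 → ℂ} (hf : Integrable f) (hg : Integrable g)
    (n : Fin 3 → ℤ) : torusCoeff (fun x => f x - g x) n = torusCoeff f n - torusCoeff g n := by
  simp only [torusCoeff, sub_mul]
  exact integral_sub (integrable_mul_torusChar hf _) (integrable_mul_torusChar hg _)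

theorem torusCoeff_const_mul (c : ℂ) (f : Torus3 → ℂ) (n : Fin 3 → ℤ) :
    torusCoeff (fun x => c * f x) n = c * torusCoeff f n := by
  simp only [torusCoeff, mul_assoc, integral_const_mul]

theorem torusCoeff_torusChar (m n : Fin 3 → ℤ) :
    torusCoeff (torusChar m) n = if m = n then 8 * (Real.pi : ℂ) ^ 3 else 0 := by
  simp only [torusCoeff, ← torusChar_add, integral_torusChar, ← sub_eq_add_neg, sub_eq_zero]

theorem torusCoeff_conj_of_real (f : Torus3 → ℝ) (n : Fin 3 → ℤ) :
    (starRingEnd ℂ) (torusCoeff (fun x => (f x : ℂ)) n) = torusCoeff (fun x => (f x : ℂ)) (-n) := by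
  simp only [torusCoeff, ← integral_conj, map_mul, Complex.conj_ofReal, torusChar_neg,
    Complex.conj_conj]

theorem Continuous.integrable_torus {f : Torus3 → ℂ} (hf : Continuous f) : Integrable f :=
  hf.integrable_of_hasCompactSupport (HasCompactSupport.of_compactSpace f)

theorem integral_mul_continuous_eq_zero {f : Torus3 → ℂ} (hf : Integrable f)
    (h0 : ∀ n, torusCoeff f n = 0) (g : C(Torus3, ℂ)) : ∫ x, f x * g x = 0 := by
  have hfg : ∀ g : C(Torus3, ℂ), Integrable fun x => f x * g x := fun g =>
    hf.mul_bdd (c := ‖g‖) g.continuous.aestronglyMeasurable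
      (Eventually.of_forall fun x => g.norm_coe_le_norm x)
  -- integration against `f` is a bounded functional which kills the characters
  let Λ : C(Torus3, ℂ) →L[ℂ] ℂ := LinearMap.mkContinuous
    { toFun := fun g => ∫ x, f x * g x
      map_add' := fun g h => by
        simp only [ContinuousMap.add_apply, mul_add]
        exact integral_add (hfg g) (hfg h)
      map_smul' := fun c g => by
        simp only [ContinuousMap.smul_apply, smul_eq_mul, RingHom.id_apply, ← integral_const_mul]
        congr 1; ext x; ring } (∫ x, ‖f x‖) (fun g => by
      simp only [LinearMap.coe_mk, AddHom.coe_mk]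
      rw [← integral_mul_const]
      refine norm_integral_le_of_norm_le (hf.norm.mul_const _) (Eventually.of_forall fun x => ?_)
      rw [norm_mul]
      exact mul_le_mul_of_nonneg_left (g.norm_coe_le_norm x) (norm_nonneg _))
  have hker : (Submodule.span ℂ (Set.range torusCharC)).topologicalClosure ≤ Λ.ker := by
    refine Submodule.topologicalClosure_minimal _ (Submodule.span_le.mpr ?_) Λ.isClosed_ker
    rintro _ ⟨n, rfl⟩
    have := h0 (-n)
    rw [torusCoeff, neg_neg] at this
    exact this
  rw [span_torusCharC_closure_eq_top] at hker
  exact hker (Submodule.mem_top (x := g))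

/-- An integrable function on the torus whose Fourier coefficients all vanish is zero almost
everywhere: it is orthogonal to all continuous functions, hence to indicators of closed sets. -/
theorem ae_eq_zero_of_torusCoeff_eq_zero {f : Torus3 → ℂ} (hf : Integrable f)
    (h0 : ∀ n, torusCoeff f n = 0) : f =ᵐ[volume] 0 := by
  refine ae_eq_zero_of_forall_setIntegral_isClosed_eq_zero hf fun s hs => ?_
  have hδ : ∀ n : ℕ, (0 : ℝ) < 1 / ((n : ℝ) + 1) := fun n => Nat.one_div_pos_of_nat
  have hlim := tendsto_one_div_add_atTop_nhds_zero_nat (𝕜 := ℝ)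
  have hzero : ∀ n : ℕ, ∫ x, f x * ((thickenedIndicator (hδ n) s x : ℝ) : ℂ) = 0 := fun n =>
    integral_mul_continuous_eq_zero hf h0 ⟨fun x => ((thickenedIndicator (hδ n) s x : ℝ) : ℂ), by
      fun_prop⟩
  have hT : Tendsto (fun n : ℕ => ∫ x, f x * ((thickenedIndicator (hδ n) s x : ℝ) : ℂ)) atTop
      (𝓝 (∫ x, s.indicator f x)) := by
    refine tendsto_integral_of_dominated_convergence (fun x => ‖f x‖) (fun n => ?_) hf.norm
      (fun n => Eventually.of_forall fun x => ?_) (Eventually.of_forall fun x => ?_)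
    · refine hf.aestronglyMeasurable.mul (Continuous.aestronglyMeasurable ?_)
      fun_prop
    · rw [norm_mul, Complex.norm_real, Real.norm_of_nonneg NNReal.zero_le_coe]
      refine mul_le_of_le_one_right (norm_nonneg _) ?_
      exact_mod_cast thickenedIndicator_le_one (hδ n) s x
    · have h1 := (tendsto_pi_nhds.mp (thickenedIndicator_tendsto_indicator_closure hδ hlim s)) x
      rw [hs.closure_eq] at h1
      have h2 : Tendsto (fun n => f x * ((thickenedIndicator (hδ n) s x : ℝ) : ℂ)) atTop
          (𝓝 (f x * (((s.indicator (fun _ => (1 : NNReal)) x : NNReal) : ℝ) : ℂ))) :=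
        (((Complex.continuous_ofReal.tendsto _).comp
          ((NNReal.continuous_coe.tendsto _).comp h1))).const_mul _
      convert h2 using 2
      by_cases hx : x ∈ s <;> simp [hx]
  rw [integral_indicator hs.measurableSet] at hT
  simp_rw [hzero] at hT
  exact tendsto_nhds_unique hT tendsto_const_nhds

/-- A continuous function on the torus is determined by its Fourier coefficients. -/
theorem Continuous.eq_of_torusCoeff_eq {f g : Torus3 → ℂ} (hf : Continuous f) (hg : Continuous g)
    (h : ∀ n, torusCoeff f n = torusCoeff g n) : f = g := by
  have h1 := ae_eq_zero_of_torusCoeff_eq_zero (hf.integrable_torus.sub hg.integrable_torus)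
    (fun n => by
      have := torusCoeff_sub hf.integrable_torus hg.integrable_torus n
      rw [h n, sub_self] at this
      exact this)
  refine (hf.ae_eq_iff_eq volume hg).mp ?_
  filter_upwards [h1] with x hx
  exact sub_eq_zero.mp hx

end Coefficients

/-! ### Absolutely convergent Fourier series -/

section Series

/-- A family of coefficients on `ℤ³` decays rapidly if it is `O(‖n‖⁻ᵏ)` for every `k`. The norm is
the supremum norm of `ℤ³`. -/
def RapidDecay (c : (Fin 3 → ℤ) → ℂ) : Prop := ∀ k : ℕ, ∃ C : ℝ, ∀ n, ‖n‖ ^ k * ‖c n‖ ≤ C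

/-- The sum of the trigonometric series with coefficients `c`. -/
noncomputable def torusSeries (c : (Fin 3 → ℤ) → ℂ) (x : Torus3) : ℂ := ∑' n, c n * torusChar n x

theorem summable_prod_one_add_sq :
    Summable fun n : Fin 3 → ℤ => ∏ i, (1 + (n i : ℝ) ^ 2)⁻¹ := by
  have h1 : Summable fun k : ℤ => (1 + (k : ℝ) ^ 2)⁻¹ := by
    refine Summable.of_norm_bounded_eventually (g := fun k : ℤ => 1 / (k : ℝ) ^ 2)
      (Real.summable_one_div_int_pow.mpr one_lt_two) ?_
    filter_upwards [(Set.finite_singleton (0 : ℤ)).compl_mem_cofinite] with k hk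
    have hk' : (k : ℝ) ≠ 0 := by exact_mod_cast hk
    rw [Real.norm_of_nonneg (by positivity), one_div]
    gcongr
    linarith
  have h2 : ∀ k : ℤ, 0 ≤ (1 + (k : ℝ) ^ 2)⁻¹ := fun k => by positivity
  have h3 := (h1.mul_of_nonneg (h1.mul_of_nonneg h1 h2 h2) h2 fun p => mul_nonneg (h2 _) (h2 _))
  let e : (Fin 3 → ℤ) → ℤ × ℤ × ℤ := fun n => (n 0, n 1, n 2)
  have he : Function.Injective e := fun m n h => by
    simp only [e, Prod.mk.injEq] at h
    ext i
    fin_cases i <;> simp [h]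
  refine (h3.comp_injective he).congr fun n => ?_
  simp only [e, Function.comp_apply, Fin.prod_univ_three, mul_assoc]

theorem RapidDecay.summable_norm_pow_mul {c : (Fin 3 → ℤ) → ℂ} (hc : RapidDecay c) (k : ℕ) :
    Summable fun n => ‖n‖ ^ k * ‖c n‖ := by
  obtain ⟨C, hC⟩ := hc k
  obtain ⟨D, hD⟩ := hc (k + 6)
  refine Summable.of_nonneg_of_le (fun n => by positivity) (fun n => ?_)
    (summable_prod_one_add_sq.mul_left (8 * (C + D)))
  -- the six extra powers pay for the summable product `∏ (1 + nᵢ²)⁻¹`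
  have hprod : ∏ i, (1 + (n i : ℝ) ^ 2) ≤ 8 * (1 + ‖n‖ ^ 6) := by
    have h1 : ∀ i ∈ Finset.univ, (1 + (n i : ℝ) ^ 2) ≤ 1 + ‖n‖ ^ 2 := fun i _ => by
      have : |(n i : ℝ)| ≤ ‖n‖ := by
        simpa only [Int.norm_eq_abs] using norm_le_pi_norm n i
      rw [← sq_abs]
      gcongr
    refine (Finset.prod_le_prod (fun i _ => by positivity) h1).trans ?_
    simp only [Finset.prod_const, Finset.card_univ, Fintype.card_fin]
    have : 0 ≤ ‖n‖ ^ 2 := by positivity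
    nlinarith [mul_nonneg this (sq_nonneg (‖n‖ ^ 2 - 1)), sq_nonneg (‖n‖ ^ 2 - 1)]
  have hpos : 0 < ∏ i, (1 + (n i : ℝ) ^ 2) := Finset.prod_pos fun i _ => by positivity
  rw [Finset.prod_inv_distrib, ← div_eq_mul_inv, le_div_iff₀ hpos]
  calc ‖n‖ ^ k * ‖c n‖ * ∏ i, (1 + (n i : ℝ) ^ 2)
      ≤ ‖n‖ ^ k * ‖c n‖ * (8 * (1 + ‖n‖ ^ 6)) := by gcongr
    _ = 8 * (‖n‖ ^ k * ‖c n‖ + ‖n‖ ^ (k + 6) * ‖c n‖) := by ring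
    _ ≤ 8 * (C + D) := by gcongr <;> apply_assumption

theorem RapidDecay.summable_norm {c : (Fin 3 → ℤ) → ℂ} (hc : RapidDecay c) :
    Summable fun n => ‖c n‖ := by simpa using hc.summable_norm_pow_mul 0

theorem RapidDecay.mul_bounded {c d : (Fin 3 → ℤ) → ℂ} (hc : RapidDecay c) {B : ℝ}
    (hd : ∀ n, ‖d n‖ ≤ B) : RapidDecay fun n => c n * d n := by
  intro k
  obtain ⟨C, hC⟩ := hc k
  refine ⟨C * B, fun n => ?_⟩
  rw [norm_mul, ← mul_assoc]
  exact mul_le_mul (hC n) (hd n) (norm_nonneg _)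
    ((by positivity : 0 ≤ ‖n‖ ^ k * ‖c n‖).trans (hC n))

theorem RapidDecay.update {c : (Fin 3 → ℤ) → ℂ} (hc : RapidDecay c) (m : Fin 3 → ℤ) (z : ℂ) :
    RapidDecay (Function.update c m z) := by
  intro k
  obtain ⟨C, hC⟩ := hc k
  refine ⟨max C (‖m‖ ^ k * ‖z‖), fun n => ?_⟩
  by_cases h : n = m
  · subst h; simp
  · rw [Function.update_of_ne h]
    exact (hC n).trans (le_max_left _ _)

theorem continuous_torusSeries {c : (Fin 3 → ℤ) → ℂ} (hc : Summable fun n => ‖c n‖) :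
    Continuous (torusSeries c) :=
  continuous_tsum (fun n => continuous_const.mul (continuous_torusChar n)) hc
    fun n x => by rw [norm_mul, norm_torusChar, mul_one]

/-- Integrating an absolutely convergent trigonometric series term by term against an integrable
function. -/
theorem integral_mul_torusSeries {f : Torus3 → ℂ} (hf : Integrable f) {c : (Fin 3 → ℤ) → ℂ}
    (hc : Summable fun n => ‖c n‖) :
    ∫ x, f x * torusSeries c x = ∑' n, c n * ∫ x, f x * torusChar n x := by
  have h := integral_tsum_of_summable_integral_norm (μ := volume)
    (F := fun (n : Fin 3 → ℤ) x => c n * (f x * torusChar n x))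
    (fun n => (integrable_mul_torusChar hf n).const_mul _) (by
      simp only [norm_mul, norm_torusChar, mul_one, integral_const_mul]
      exact hc.mul_right _)
  simp only [integral_const_mul] at h
  rw [h]
  congr 1
  ext x
  rw [torusSeries, ← tsum_mul_left]
  congr 1
  ext n
  ring

theorem torusCoeff_torusSeries {c : (Fin 3 → ℤ) → ℂ} (hc : Summable fun n => ‖c n‖)
    (n : Fin 3 → ℤ) : torusCoeff (torusSeries c) n = 8 * (Real.pi : ℂ) ^ 3 * c n := by
  have h := integral_mul_torusSeries (continuous_torusChar (-n)).integrable_torus hc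
  simp only [mul_comm (torusChar (-n) _)] at h
  rw [torusCoeff, h, tsum_eq_single n]
  · have := torusCoeff_torusChar n n
    rw [torusCoeff, if_pos rfl] at this
    rw [this]; ring
  · intro m hm
    have := torusCoeff_torusChar m n
    rw [torusCoeff, if_neg hm] at this
    rw [this, mul_zero]

theorem pi_cube_ne_zero : 8 * (Real.pi : ℂ) ^ 3 ≠ 0 :=
  mul_ne_zero (by norm_num) (pow_ne_zero _ (Complex.ofReal_ne_zero.mpr Real.pi_ne_zero))

theorem Continuous.eq_torusSeries {f : Torus3 → ℂ} (hf : Continuous f)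
    (hs : Summable fun n => ‖torusCoeff f n‖) :
    f = torusSeries fun n => torusCoeff f n / (8 * (Real.pi : ℂ) ^ 3) := by
  have hs' : Summable fun n => ‖torusCoeff f n / (8 * (Real.pi : ℂ) ^ 3)‖ := by
    simp only [norm_div]
    exact hs.div_const _
  refine hf.eq_of_torusCoeff_eq (continuous_torusSeries hs') fun n => ?_
  rw [torusCoeff_torusSeries hs', mul_div_cancel₀ _ pi_cube_ne_zero]

theorem torusConv_torusSeries {f : Torus3 → ℂ} (hf : Integrable f) {c : (Fin 3 → ℤ) → ℂ}
    (hc : Summable fun n => ‖c n‖) :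
    torusConv f (torusSeries c) = torusSeries fun n => c n * torusCoeff f n := by
  ext x
  have hneg : ∀ (n : Fin 3 → ℤ) (y : Torus3),
      torusChar n (x - y) = torusChar n x * torusChar (-n) y := fun n y => by
    rw [sub_eq_add_neg, torusChar_apply_add, torusChar_apply_neg]
  have h1 : ∀ y, torusSeries c (x - y) = torusSeries (fun n => c (-n) * torusChar (-n) x) y := by
    intro y
    rw [torusSeries, torusSeries, ← (Equiv.neg (Fin 3 → ℤ)).tsum_eq]
    congr 1
    ext n
    simp only [Equiv.neg_apply, hneg, neg_neg]
    ring
  simp only [torusConv_apply, h1]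
  rw [integral_mul_torusSeries hf, torusSeries, ← (Equiv.neg (Fin 3 → ℤ)).tsum_eq]
  · congr 1
    ext n
    simp only [Equiv.neg_apply, neg_neg, torusCoeff]
    ring
  · simp only [norm_mul, norm_torusChar, mul_one]
    exact hc.comp_injective neg_injective

theorem torusConv_torusChar (f : Torus3 → ℂ) (n : Fin 3 → ℤ) (x : Torus3) :
    torusConv f (torusChar n) x = torusCoeff f n * torusChar n x := by
  simp only [torusConv_apply, torusCoeff, ← integral_mul_const]
  congr 1
  ext y
  rw [sub_eq_add_neg, torusChar_apply_add, torusChar_apply_neg]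
  ring

theorem torusSeries_conj {c : (Fin 3 → ℤ) → ℂ} (h : ∀ n, (starRingEnd ℂ) (c n) = c (-n))
    (x : Torus3) : (starRingEnd ℂ) (torusSeries c x) = torusSeries c x := by
  rw [torusSeries, Complex.conj_tsum, ← (Equiv.neg (Fin 3 → ℤ)).tsum_eq]
  simp [h, torusChar_neg]

end Series

/-! ### Fourier series in the space of square-integrable functions -/

section SquareIntegrable

/-- The `L²` Fourier expansion of a square-integrable function, with unconditional convergence. -/
theorem tendsto_torusSeries_of_memLp {f : Torus3 → ℂ} (hf : MemLp f 2 volume) :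
    Tendsto (fun s : Finset (Fin 3 → ℤ) => eLpNorm (fun x => f x -
      ∑ n ∈ s, torusCoeff f n / (8 * (Real.pi : ℂ) ^ 3) * torusChar n x) 2 volume)
      atTop (𝓝 0) := by
  set V : ℝ := 8 * Real.pi ^ 3 with hV
  have hVpos : 0 < V := by positivity
  have hVc : (8 * (Real.pi : ℂ) ^ 3) = ((√V : ℝ) : ℂ) * ((√V : ℝ) : ℂ) := by
    rw [← Complex.ofReal_mul, Real.mul_self_sqrt hVpos.le, hV]; push_cast; rfl
  have hsq : ((√V : ℝ) : ℂ) ≠ 0 := Complex.ofReal_ne_zero.mpr (Real.sqrt_pos.mpr hVpos).ne'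
  -- the volume is `V`, so the characters have to be divided by `√V` to become orthonormal
  let e : (Fin 3 → ℤ) → Lp ℂ 2 (volume : Measure Torus3) := fun n =>
    ((√V : ℝ) : ℂ)⁻¹ • ContinuousMap.toLp (E := ℂ) 2 volume ℂ (torusCharC n)
  have hortho : Orthonormal ℂ e := by
    rw [orthonormal_iff_ite]
    intro m n
    simp only [e, inner_smul_left, inner_smul_right, ContinuousMap.inner_toLp, torusCharC_apply,
      ← torusChar_neg]
    have := torusCoeff_torusChar n m
    rw [torusCoeff] at this
    rw [this, map_inv₀, Complex.conj_ofReal]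
    by_cases h : m = n
    · rw [if_pos h, if_pos h.symm, hVc]; field_simp
    · rw [if_neg h, if_neg (Ne.symm h)]; simp
  have hspan : ⊤ ≤ (Submodule.span ℂ (Set.range e)).topologicalClosure := by
    have h1 : (Submodule.span ℂ (Set.range fun n =>
        ContinuousMap.toLp (E := ℂ) 2 (volume : Measure Torus3) ℂ
          (torusCharC n))).topologicalClosure = ⊤ := by
      simpa only [Submodule.map_span, ContinuousLinearMap.coe_coe, ← Set.range_comp,
        Function.comp_def] using
        (ContinuousMap.toLp_denseRange ℂ (volume : Measure Torus3) ℂ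
          (p := 2) (by simp)).topologicalClosure_map_submodule span_torusCharC_closure_eq_top
    rw [← h1]
    refine Submodule.topologicalClosure_mono (Submodule.span_le.mpr ?_)
    rintro _ ⟨n, rfl⟩
    have := Submodule.smul_mem _ ((√V : ℝ) : ℂ)
      (Submodule.subset_span (R := ℂ) (Set.mem_range_self (f := e) n))
    simpa [e, smul_smul, hsq] using this
  let b := HilbertBasis.mk hortho hspan
  have hb : ⇑b = e := HilbertBasis.coe_mk _ _
  have hsum := b.hasSum_repr (hf.toLp f)
  have hterm : ∀ n, b.repr (hf.toLp f) n • b n =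
      (torusCoeff f n / (8 * (Real.pi : ℂ) ^ 3)) •
        ContinuousMap.toLp (E := ℂ) 2 volume ℂ (torusCharC n) := by
    intro n
    rw [b.repr_apply_apply, hb]
    simp only [e, inner_smul_left, smul_smul, map_inv₀, Complex.conj_ofReal]
    have : inner ℂ (ContinuousMap.toLp (E := ℂ) 2 volume ℂ (torusCharC n)) (hf.toLp f)
        = torusCoeff f n := by
      rw [MeasureTheory.L2.inner_def, torusCoeff]
      apply integral_congr_ae
      filter_upwards [ContinuousMap.coeFn_toLp (p := 2) (𝕜 := ℂ) volume (torusCharC n),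
        hf.coeFn_toLp] with x h1 h2
      rw [h1, h2, RCLike.inner_apply, torusCharC_apply, torusChar_neg]
    rw [this, hVc]
    congr 1
    field_simp
  simp only [hterm] at hsum
  have hmem : ∀ s : Finset (Fin 3 → ℤ), MemLp (fun x =>
      ∑ n ∈ s, torusCoeff f n / (8 * (Real.pi : ℂ) ^ 3) * torusChar n x) 2 volume := fun s => by
    have hc : Continuous fun x : Torus3 =>
        ∑ n ∈ s, torusCoeff f n / (8 * (Real.pi : ℂ) ^ 3) * torusChar n x :=
      continuous_finsetSum _ fun n _ => continuous_const.mul (continuous_torusChar n)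
    exact hc.memLp_of_hasCompactSupport (HasCompactSupport.of_compactSpace _)
  have hsum' : Tendsto (fun s => (hmem s).toLp _) atTop (𝓝 (hf.toLp f)) := by
    refine hsum.congr fun s => ?_
    have h3 : ∑ n ∈ s, (torusCoeff f n / (8 * (Real.pi : ℂ) ^ 3)) •
        ContinuousMap.toLp (E := ℂ) 2 volume ℂ (torusCharC n) =
        ContinuousMap.toLp (E := ℂ) 2 (volume : Measure Torus3) ℂ
          (∑ n ∈ s, (torusCoeff f n / (8 * (Real.pi : ℂ) ^ 3)) • torusCharC n) := by
      simp only [map_sum, map_smul]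
    rw [h3]
    refine Lp.ext ?_
    filter_upwards [(hmem s).coeFn_toLp, ContinuousMap.coeFn_toLp (p := 2) (𝕜 := ℂ) volume
      (∑ n ∈ s, (torusCoeff f n / (8 * (Real.pi : ℂ) ^ 3)) • torusCharC n)] with x h4 h5
    rw [h4, h5]
    simp
  rw [Lp.tendsto_Lp_iff_tendsto_eLpNorm''] at hsum'
  refine hsum'.congr fun s => ?_
  rw [eLpNorm_sub_comm]
  rfl

end SquareIntegrable

/-! ### Smooth functions on the torus and their Fourier coefficients -/

section Smoothness

theorem torusProj_add (v w : EuclideanSpace ℝ (Fin 3)) :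
    torusProj (v + w) = torusProj v + torusProj w := by
  ext i
  simp [torusProj]

theorem torusProj_zero : torusProj 0 = 0 := by
  ext i
  simp [torusProj]

theorem isOpenQuotientMap_torusProj : IsOpenQuotientMap torusProj := by
  have h1 : IsOpenQuotientMap (Pi.map fun (_ : Fin 3) (t : ℝ) => (t : AddCircle (2 * Real.pi))) :=
    IsOpenQuotientMap.piMap fun _ => QuotientAddGroup.isOpenQuotientMap_mk
  exact h1.comp (PiLp.homeomorph 2 (fun _ : Fin 3 => ℝ)).isOpenQuotientMap

theorem continuous_torusProj : Continuous torusProj := isOpenQuotientMap_torusProj.continuous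

variable {F : Type*} [NormedAddCommGroup F] [NormedSpace ℝ F]

theorem torusSmoothAt_torusProj_iff {f : Torus3 → F} {w : EuclideanSpace ℝ (Fin 3)} :
    TorusSmoothAt f (torusProj w) ↔ ContDiffAt ℝ ∞ (fun v => f (torusProj v)) w := by
  unfold TorusSmoothAt
  simp_rw [← torusProj_add]
  constructor
  · intro h
    have h' : ContDiffAt ℝ ∞ (fun v => f (torusProj (w + v))) (w - w) := by rwa [sub_self]
    have := h'.comp w (f := fun v => v - w) (by fun_prop)
    simpa [Function.comp_def] using this
  · intro h
    have h' : ContDiffAt ℝ ∞ (fun v => f (torusProj v)) (w + 0) := by rwa [add_zero]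
    exact h'.comp (0 : EuclideanSpace ℝ (Fin 3)) (f := fun v => w + v) (by fun_prop)

theorem torusSmooth_iff {f : Torus3 → F} :
    TorusSmooth f ↔ ContDiff ℝ ∞ fun v => f (torusProj v) := by
  rw [contDiff_iff_contDiffAt]
  constructor
  · exact fun h w => torusSmoothAt_torusProj_iff.mp (h _)
  · intro h x
    obtain ⟨w, rfl⟩ := isOpenQuotientMap_torusProj.surjective x
    exact torusSmoothAt_torusProj_iff.mpr (h w)

theorem TorusSmooth.continuous {f : Torus3 → F} (hf : TorusSmooth f) : Continuous f :=
  isOpenQuotientMap_torusProj.isQuotientMap.continuous_iff.mpr (torusSmooth_iff.mp hf).continuous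

/-- The partial derivative `∂f/∂xᵢ` on the torus, computed in the flat chart centred at the
point. -/
noncomputable def torusPartial (i : Fin 3) (f : Torus3 → ℂ) (x : Torus3) : ℂ :=
  fderiv ℝ (fun v => f (x + torusProj v)) 0 (EuclideanSpace.single i 1)

theorem torusPartial_torusProj (i : Fin 3) (f : Torus3 → ℂ) (w : EuclideanSpace ℝ (Fin 3)) :
    torusPartial i f (torusProj w) =
      fderiv ℝ (fun v => f (torusProj v)) w (EuclideanSpace.single i 1) := by
  unfold torusPartial
  simp_rw [← torusProj_add]
  rw [fderiv_comp_add_left (f := fun v => f (torusProj v)) w, add_zero]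

theorem TorusSmooth.torusPartial {f : Torus3 → ℂ} (hf : TorusSmooth f) (i : Fin 3) :
    TorusSmooth (torusPartial i f) := by
  rw [torusSmooth_iff] at hf ⊢
  simp_rw [torusPartial_torusProj]
  exact (hf.fderiv_right (m := ∞) (by simp)).clm_apply contDiff_const

theorem torusLaplacian_eq_sum {f : Torus3 → ℂ} (hf : TorusSmooth f) (x : Torus3) :
    torusLaplacian f x = -∑ i, torusPartial i (torusPartial i f) x := by
  obtain ⟨w, rfl⟩ := isOpenQuotientMap_torusProj.surjective x
  rw [torusSmooth_iff] at hf
  have hd : DifferentiableAt ℝ (fderiv ℝ (fun v => f (torusProj v))) w :=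
    ((hf.fderiv_right (m := ∞) (by simp)).differentiable (by simp)) w
  have hg : (fun v => f (torusProj w + torusProj v)) = fun v => f (torusProj (w + v)) := by
    simp_rw [torusProj_add]
  unfold torusLaplacian
  rw [hg, InnerProductSpace.laplacian_eq_iteratedFDeriv_orthonormalBasis _
    (EuclideanSpace.basisFun (Fin 3) ℝ)]
  beta_reduce
  congr 1
  refine Finset.sum_congr rfl fun i _ => ?_
  rw [torusPartial_torusProj]
  simp_rw [torusPartial_torusProj]
  rw [iteratedFDeriv_comp_add_left (f := fun v => f (torusProj v)), add_zero,
    iteratedFDeriv_two_apply, fderiv_clm_apply hd (by fun_prop)]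
  simp

theorem torusChar_torusProj_single (n : Fin 3 → ℤ) (i : Fin 3) (t : ℝ) :
    torusChar n (torusProj (t • EuclideanSpace.single i 1)) =
      Complex.exp (Complex.I * n i * t) := by
  rw [torusChar_torusProj]
  congr 1
  rw [Finset.sum_eq_single i]
  · simp [mul_assoc]
  · intro j _ hj
    simp [hj]
  · simp

/-- Differentiation multiplies the Fourier coefficients by `i nᵢ`: translating `f` along the `i`-th
axis multiplies them by an exponential, and one differentiates under the integral sign. -/
theorem torusCoeff_torusPartial {f : Torus3 → ℂ} (hf : TorusSmooth f) (i : Fin 3)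
    (n : Fin 3 → ℤ) :
    torusCoeff (torusPartial i f) n = Complex.I * n i * torusCoeff f n := by
  set p : ℝ → Torus3 := fun t => torusProj (t • EuclideanSpace.single i 1) with hp
  have hpc : Continuous p := continuous_torusProj.comp (by fun_prop)
  have htrans : ∀ t : ℝ, ∫ x, f (x + p t) * torusChar (-n) x =
      Complex.exp (Complex.I * n i * t) * torusCoeff f n := by
    intro t
    rw [torusCoeff, ← integral_add_right_eq_self (fun x => f x * torusChar (-n) x) (p t),
      ← integral_const_mul]
    congr 1
    ext x
    simp only [hp]
    rw [torusChar_apply_add, torusChar_torusProj_single, mul_left_comm,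
      mul_left_comm (Complex.exp _), ← Complex.exp_add]
    simp
  have hpart := (hf.torusPartial i).continuous
  obtain ⟨C, hC⟩ := (isCompact_range hpart).isBounded.exists_norm_le
  have hder := hasDerivAt_integral_of_dominated_loc_of_deriv_le (μ := (volume : Measure Torus3))
    (F := fun (t : ℝ) x => f (x + p t) * torusChar (-n) x)
    (F' := fun (t : ℝ) x => torusPartial i f (x + p t) * torusChar (-n) x)
    (x₀ := 0) (bound := fun _ => C) (s := Set.univ) Filter.univ_mem
    (Eventually.of_forall fun t => by
      have h1 := hf.continuous
      have h2 := continuous_torusChar (-n)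
      exact Continuous.aestronglyMeasurable (by fun_prop))
    (by
      have h1 := hf.continuous
      have h2 := continuous_torusChar (-n)
      exact Continuous.integrable_torus (by fun_prop))
    (by
      have h2 := continuous_torusChar (-n)
      exact Continuous.aestronglyMeasurable (by fun_prop))
    (Eventually.of_forall fun x t _ => by
      rw [norm_mul, norm_torusChar, mul_one]
      exact hC _ (Set.mem_range_self _))
    (integrable_const C)
    (Eventually.of_forall fun x t _ => by
      refine HasDerivAt.mul_const ?_ _
      obtain ⟨w, rfl⟩ := isOpenQuotientMap_torusProj.surjective x
      simp only [hp, ← torusProj_add, torusPartial_torusProj]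
      have hd : DifferentiableAt ℝ (fun v => f (torusProj v))
          (w + t • EuclideanSpace.single i 1) :=
        (torusSmooth_iff.mp hf).differentiable (by simp) _
      refine hd.hasFDerivAt.comp_hasDerivAt t
        (f := fun t : ℝ => w + t • EuclideanSpace.single i (1 : ℝ)) ?_
      simpa using ((hasDerivAt_id t).smul_const (EuclideanSpace.single i (1 : ℝ))).const_add w)
  have hder2 := hder.2
  simp_rw [htrans] at hder2
  have hexp : HasDerivAt (fun t : ℝ => Complex.exp (Complex.I * n i * t) * torusCoeff f n)
      (Complex.I * n i * torusCoeff f n) 0 := by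
    have h1 : HasDerivAt (fun t : ℝ => Complex.I * n i * (t : ℂ)) (Complex.I * n i) 0 := by
      simpa using (Complex.ofRealCLM.hasDerivAt (x := (0 : ℝ))).const_mul (Complex.I * (n i : ℂ))
    simpa using h1.cexp.mul_const (torusCoeff f n)
  have h0 : p 0 = 0 := by simp [hp, torusProj_zero]
  simpa [h0, torusCoeff] using hder2.unique hexp

theorem continuous_torusLaplacian {f : Torus3 → ℂ} (hf : TorusSmooth f) :
    Continuous (torusLaplacian f) := by
  rw [funext (torusLaplacian_eq_sum hf)]
  exact (continuous_finsetSum _ fun i _ => ((hf.torusPartial i).torusPartial i).continuous).neg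

/-- `‖n‖² = n₁² + n₂² + n₃²`, the eigenvalue of the Laplacian on the character `e^{i n·x}`. -/
noncomputable def torusEigenvalue (n : Fin 3 → ℤ) : ℂ := ∑ i, (n i : ℂ) ^ 2

/-- The Laplacian is diagonal in the Fourier basis. -/
theorem torusCoeff_torusLaplacian {f : Torus3 → ℂ} (hf : TorusSmooth f) (n : Fin 3 → ℤ) :
    torusCoeff (torusLaplacian f) n = torusEigenvalue n * torusCoeff f n := by
  have h : torusLaplacian f = fun x => -1 * (torusPartial 0 (torusPartial 0 f) x +
      torusPartial 1 (torusPartial 1 f) x + torusPartial 2 (torusPartial 2 f) x) := by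
    ext x
    rw [torusLaplacian_eq_sum hf, Fin.sum_univ_three]
    ring
  have hi : ∀ i, Integrable (torusPartial i (torusPartial i f)) := fun i =>
    ((hf.torusPartial i).torusPartial i).continuous.integrable_torus
  rw [h, torusCoeff_const_mul, torusCoeff_add (by exact (hi 0).add (hi 1)) (hi 2),
    torusCoeff_add (hi 0) (hi 1)]
  simp only [torusCoeff_torusPartial (hf.torusPartial _), torusCoeff_torusPartial hf,
    torusEigenvalue, Fin.sum_univ_three]
  linear_combination (-torusCoeff f n * ((n 0 : ℂ) ^ 2 + (n 1 : ℂ) ^ 2 + (n 2 : ℂ) ^ 2)) *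
    Complex.I_sq

theorem norm_torusCoeff_le {f : Torus3 → ℂ} (n : Fin 3 → ℤ) :
    ‖torusCoeff f n‖ ≤ ∫ x, ‖f x‖ := by
  refine (norm_integral_le_integral_norm _).trans_eq ?_
  simp [norm_torusChar]

/-- The Fourier coefficients of a smooth function decay rapidly. -/
theorem TorusSmooth.rapidDecay {f : Torus3 → ℂ} (hf : TorusSmooth f) :
    RapidDecay (torusCoeff f) := by
  intro k
  have hiter : ∀ i, ∃ C, ∀ n, |(n i : ℝ)| ^ k * ‖torusCoeff f n‖ ≤ C := by
    intro i
    have hind : ∀ k : ℕ, TorusSmooth ((_root_.torusPartial i)^[k] f) ∧ ∀ n,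
        torusCoeff ((_root_.torusPartial i)^[k] f) n = (Complex.I * n i) ^ k * torusCoeff f n := by
      intro k
      induction k with
      | zero => exact ⟨hf, fun n => by simp⟩
      | succ k ih =>
        rw [Function.iterate_succ_apply']
        exact ⟨ih.1.torusPartial i, fun n => by
          rw [torusCoeff_torusPartial ih.1, ih.2]; ring⟩
    refine ⟨∫ x, ‖(_root_.torusPartial i)^[k] f x‖, fun n => ?_⟩
    have := norm_torusCoeff_le (f := (_root_.torusPartial i)^[k] f) n
    rw [(hind k).2] at this
    simpa using this
  choose C hC using hiter
  refine ⟨∑ i, |C i|, fun n => ?_⟩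
  obtain ⟨i, hi⟩ : ∃ i, ‖n i‖ = ‖n‖ := by
    obtain ⟨i, -, hi⟩ := Finset.exists_mem_eq_sup Finset.univ Finset.univ_nonempty fun i => ‖n i‖₊
    exact ⟨i, by rw [← coe_nnnorm, ← coe_nnnorm, Pi.nnnorm_def, hi]⟩
  rw [← hi, Int.norm_eq_abs]
  exact (hC i n).trans ((le_abs_self _).trans
    (Finset.single_le_sum (f := fun i => |C i|) (fun j _ => abs_nonneg _) (Finset.mem_univ i)))

/-- The linear form `v ↦ n·v`. -/
noncomputable def torusFreq (n : Fin 3 → ℤ) : EuclideanSpace ℝ (Fin 3) →L[ℝ] ℝ :=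
  ∑ i, (n i : ℝ) • EuclideanSpace.proj i

theorem norm_torusFreq_le (n : Fin 3 → ℤ) : ‖torusFreq n‖ ≤ 3 * ‖n‖ := by
  refine ContinuousLinearMap.opNorm_le_bound _ (by positivity) fun v => ?_
  simp only [torusFreq, sum_apply, smul_apply,
    PiLp.proj_apply, smul_eq_mul]
  refine (norm_sum_le _ _).trans ?_
  have : ∀ i ∈ Finset.univ, ‖(n i : ℝ) * v i‖ ≤ ‖n‖ * ‖v‖ := fun i _ => by
    rw [norm_mul]
    gcongr
    · simpa only [Int.norm_eq_abs, Real.norm_eq_abs] using norm_le_pi_norm n i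
    · exact PiLp.norm_apply_le v i
  refine (Finset.sum_le_sum this).trans_eq ?_
  simp
  ring

theorem torusChar_torusProj_eq_comp (n : Fin 3 → ℤ) : (fun v => torusChar n (torusProj v)) =
    (fun t : ℝ => Complex.exp (Complex.I * t)) ∘ torusFreq n := by
  ext v
  rw [torusChar_torusProj]
  simp [torusFreq]

theorem contDiff_exp_I_mul {k : ℕ∞ω} : ContDiff ℝ k fun t : ℝ => Complex.exp (Complex.I * t) :=
  (contDiff_const.mul Complex.ofRealCLM.contDiff).cexp

theorem contDiff_torusChar_torusProj (n : Fin 3 → ℤ) :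
    ContDiff ℝ ∞ fun v => torusChar n (torusProj v) := by
  rw [torusChar_torusProj_eq_comp]
  exact contDiff_exp_I_mul.comp
    (torusFreq n).contDiff

theorem iteratedDeriv_exp_I_mul (k : ℕ) : iteratedDeriv k (fun t : ℝ => Complex.exp (Complex.I * t))
    = fun t : ℝ => Complex.I ^ k * Complex.exp (Complex.I * t) := by
  induction k with
  | zero => simp
  | succ k ih =>
    rw [iteratedDeriv_succ, ih]
    ext t
    have h1 : HasDerivAt (fun t : ℝ => Complex.I * (t : ℂ)) Complex.I t := by
      simpa using (Complex.ofRealCLM.hasDerivAt (x := t)).const_mul Complex.I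
    rw [(h1.cexp.const_mul (Complex.I ^ k)).deriv]
    ring

theorem norm_iteratedFDeriv_torusChar_le (n : Fin 3 → ℤ) (k : ℕ)
    (v : EuclideanSpace ℝ (Fin 3)) :
    ‖iteratedFDeriv ℝ k (fun v => torusChar n (torusProj v)) v‖ ≤ (3 * ‖n‖) ^ k := by
  rw [torusChar_torusProj_eq_comp, (torusFreq n).iteratedFDeriv_comp_right (n := k)
    contDiff_exp_I_mul v le_rfl]
  refine (ContinuousMultilinearMap.norm_compContinuousLinearMap_le _ _).trans ?_
  rw [norm_iteratedFDeriv_eq_norm_iteratedDeriv, iteratedDeriv_exp_I_mul]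
  simp only [norm_mul, norm_pow, Complex.norm_I, one_pow, Complex.norm_exp_I_mul_ofReal, mul_one,
    one_mul, Finset.prod_const, Finset.card_univ, Fintype.card_fin]
  gcongr
  exact norm_torusFreq_le n

/-- A trigonometric series with rapidly decaying coefficients can be differentiated term by term
any number of times. -/
theorem RapidDecay.torusSmooth {c : (Fin 3 → ℤ) → ℂ} (hc : RapidDecay c) :
    TorusSmooth (torusSeries c) := by
  rw [torusSmooth_iff]
  have := contDiff_tsum (𝕜 := ℝ) (N := (⊤ : ℕ∞))
    (f := fun n v => c n * torusChar n (torusProj v))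
    (v := fun k n => 3 ^ k * (‖n‖ ^ k * ‖c n‖))
    (fun n => contDiff_const.mul (contDiff_torusChar_torusProj n))
    (fun k _ => (hc.summable_norm_pow_mul k).mul_left _) (fun k n v _ => by
      have hs : (fun v => c n * torusChar n (torusProj v)) =
        c n • fun v => torusChar n (torusProj v) := rfl
      rw [hs, iteratedFDeriv_const_smul_apply
        ((contDiff_torusChar_torusProj n).of_le (by exact_mod_cast le_top)).contDiffAt, norm_smul]
      calc _ ≤ ‖c n‖ * (3 * ‖n‖) ^ k := by
            gcongr; exact norm_iteratedFDeriv_torusChar_le n k v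
        _ = _ := by rw [mul_pow]; ring)
  exact this

theorem TorusSmooth.eq_torusSeries {f : Torus3 → ℂ} (hf : TorusSmooth f) :
    f = torusSeries fun n => torusCoeff f n * (8 * (Real.pi : ℂ) ^ 3)⁻¹ := by
  simpa only [div_eq_mul_inv] using hf.continuous.eq_torusSeries hf.rapidDecay.summable_norm

theorem torusSmooth_torusChar (n : Fin 3 → ℤ) : TorusSmooth (torusChar n) :=
  torusSmooth_iff.mpr (contDiff_torusChar_torusProj n)

end Smoothness

/-! ### Transplanting functions from a fundamental cube -/

section Representatives

/-- The representative in the cube `(-π, π]³` of a point of the torus. -/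
noncomputable def torusRep (x : Torus3) : EuclideanSpace ℝ (Fin 3) :=
  WithLp.toLp 2 fun i => (AddCircle.equivIoc (2 * Real.pi) (-Real.pi) (x i) : ℝ)

/-- The cube `(-π, π]³`. -/
def torusCube : Set (EuclideanSpace ℝ (Fin 3)) :=
  {v | ∀ i, v i ∈ Set.Ioc (-Real.pi) (-Real.pi + 2 * Real.pi)}

theorem torusProj_torusRep (x : Torus3) : torusProj (torusRep x) = x := by
  ext i
  exact (AddCircle.equivIoc (2 * Real.pi) (-Real.pi)).symm_apply_apply (x i)

theorem torusRep_torusProj {v : EuclideanSpace ℝ (Fin 3)} (hv : v ∈ torusCube) :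
    torusRep (torusProj v) = v := by
  ext i
  exact congrArg Subtype.val
    ((AddCircle.equivIoc (2 * Real.pi) (-Real.pi)).apply_symm_apply ⟨v i, hv i⟩)

theorem mem_torusCube_of_abs_le {v : EuclideanSpace ℝ (Fin 3)} (h : ∀ i, |v i| ≤ 3) :
    v ∈ torusCube := fun i => by
  have := abs_le.mp (h i)
  have := Real.pi_gt_three
  constructor <;> linarith

theorem mem_torusCube_of_norm_le {v : EuclideanSpace ℝ (Fin 3)} (h : ‖v‖ ≤ 3) : v ∈ torusCube :=
  mem_torusCube_of_abs_le fun i => (PiLp.norm_apply_le v i).trans h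

theorem torusRep_eq_zero {x : Torus3} : torusRep x = 0 ↔ x = 0 := by
  constructor
  · intro h
    rw [← torusProj_torusRep x, h, torusProj_zero]
  · rintro rfl
    rw [← torusProj_zero, torusRep_torusProj (mem_torusCube_of_norm_le (by simp))]

/-- The covering projection is measure preserving from the cube `(-π, π]³` onto the torus. -/
theorem measurePreserving_torusProj :
    MeasurePreserving torusProj (volume.restrict torusCube) volume := by
  have h1 : MeasurePreserving
      (fun (v : Fin 3 → ℝ) (i : Fin 3) => ((v i : ℝ) : AddCircle (2 * Real.pi)))
      (Measure.pi fun _ => volume.restrict (Set.Ioc (-Real.pi) (-Real.pi + 2 * Real.pi)))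
      (Measure.pi fun _ => volume) :=
    measurePreserving_pi _ _ fun _ => AddCircle.measurePreserving_mk (2 * Real.pi) (-Real.pi)
  rw [← Measure.restrict_pi_pi] at h1
  have h2 := (EuclideanSpace.volume_preserving_symm_measurableEquiv_toLp (Fin 3)).restrict_preimage
    (s := Set.univ.pi fun _ => Set.Ioc (-Real.pi) (-Real.pi + 2 * Real.pi))
    (MeasurableSet.univ_pi fun _ => measurableSet_Ioc)
  have h3 := h1.comp h2
  have hs : (MeasurableEquiv.toLp 2 (Fin 3 → ℝ)).symm ⁻¹'
      (Set.univ.pi fun _ => Set.Ioc (-Real.pi) (-Real.pi + 2 * Real.pi)) = torusCube := by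
    ext v
    simp [torusCube]
  rw [hs] at h3
  exact h3

theorem measurableSet_torusCube : MeasurableSet torusCube := by
  have : torusCube = ⋂ i, (fun v : EuclideanSpace ℝ (Fin 3) => v i) ⁻¹'
      Set.Ioc (-Real.pi) (-Real.pi + 2 * Real.pi) := by
    ext v; simp [torusCube]
  rw [this]
  exact MeasurableSet.iInter fun i => measurableSet_Ioc.preimage (by fun_prop)

theorem measurable_torusRep : Measurable torusRep := by
  refine (MeasurableEquiv.toLp 2 (Fin 3 → ℝ)).measurable.comp (measurable_pi_lambda _ fun i => ?_)
  exact measurable_subtype_coe.comp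
    ((AddCircle.measurableEquivIoc (2 * Real.pi) (-Real.pi)).measurable.comp
      (measurable_pi_apply i))

theorem measurePreserving_torusRep :
    MeasurePreserving torusRep volume (volume.restrict torusCube) := by
  refine ⟨measurable_torusRep, ?_⟩
  rw [← measurePreserving_torusProj.map_eq,
    Measure.map_map measurable_torusRep measurePreserving_torusProj.measurable]
  conv_rhs => rw [← Measure.map_id (μ := volume.restrict torusCube)]
  refine Measure.map_congr ?_
  filter_upwards [ae_restrict_mem measurableSet_torusCube] with v hv
  exact torusRep_torusProj hv

variable {F : Type*}

/-- The function on the torus obtained by transplanting `g` from the cube `(-π, π]³`. -/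
noncomputable def torusLift (g : EuclideanSpace ℝ (Fin 3) → F) (x : Torus3) : F := g (torusRep x)

/-- If `g` vanishes outside the open unit ball, its transplant to the torus agrees with `g` in the
flat charts. The faces of the cube `(-π, π]³` do no harm, because they are at distance more than
`1` from the unit ball. -/
theorem torusLift_eventuallyEq [Zero F] {g : EuclideanSpace ℝ (Fin 3) → F}
    (hg : ∀ v, 1 ≤ ‖v‖ → g v = 0) (x : Torus3) :
    (fun v => torusLift g (x + torusProj v)) =ᶠ[𝓝 0] fun v => g (torusRep x + v) := by
  filter_upwards [Metric.ball_mem_nhds (0 : EuclideanSpace ℝ (Fin 3)) one_pos] with v hv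
  have hv1 : ∀ i, |v i| < 1 := fun i =>
    (PiLp.norm_apply_le v i).trans_lt (by simpa using hv)
  unfold torusLift
  -- if every coordinate is at most `2`, adding `v` does not leave the cube, as `2 + 1 < π`;
  -- otherwise both sides vanish
  by_cases h : ∀ i, |torusRep x i| ≤ 2
  · conv_lhs => rw [← torusProj_torusRep x, ← torusProj_add]
    rw [torusRep_torusProj (mem_torusCube_of_abs_le fun i => ?_)]
    exact (abs_add_le (torusRep x i) (v i)).trans (by linarith [h i, hv1 i])
  · push Not at h
    obtain ⟨i, hi⟩ := h
    rw [hg, hg]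
    · refine le_trans ?_ (PiLp.norm_apply_le _ i)
      have := abs_sub_abs_le_abs_sub (torusRep x i) (-v i)
      rw [abs_neg, sub_neg_eq_add] at this
      rw [PiLp.add_apply, Real.norm_eq_abs]
      linarith [hv1 i]
    · by_contra hlt
      have hr : |torusRep (x + torusProj v) i| < 1 :=
        (PiLp.norm_apply_le _ i).trans_lt (not_le.mp hlt)
      set r := torusRep (x + torusProj v) i with hrdef
      have hlt2 : |r - v i| < 2 := (abs_sub _ _).trans_lt (by linarith [hv1 i])
      have hx : x i = ((r - v i : ℝ) : AddCircle (2 * Real.pi)) := by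
        have := congrFun (torusProj_torusRep (x + torusProj v)) i
        simp only [torusProj, Pi.add_apply, ← hrdef] at this
        rw [AddCircle.coe_sub, this, add_sub_cancel_right]
      have hmem : r - v i ∈ Set.Ioc (-Real.pi) (-Real.pi + 2 * Real.pi) := by
        have := abs_lt.mp hlt2
        have := Real.pi_gt_three
        constructor <;> linarith
      have : torusRep x i = r - v i := by
        simp only [torusRep, hx]
        exact congrArg Subtype.val
          ((AddCircle.equivIoc (2 * Real.pi) (-Real.pi)).apply_symm_apply ⟨_, hmem⟩)
      rw [this] at hi
      linarith

theorem torusSmoothAt_torusLift [NormedAddCommGroup F] [NormedSpace ℝ F]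
    {g : EuclideanSpace ℝ (Fin 3) → F} (hg : ∀ v, 1 ≤ ‖v‖ → g v = 0) {x : Torus3}
    (h : ContDiffAt ℝ ∞ g (torusRep x)) : TorusSmoothAt (torusLift g) x := by
  refine ContDiffAt.congr_of_eventuallyEq ?_ (torusLift_eventuallyEq hg x)
  have h' : ContDiffAt ℝ ∞ g (torusRep x + 0) := by rwa [add_zero]
  exact h'.comp (0 : EuclideanSpace ℝ (Fin 3)) (f := fun v => torusRep x + v) (by fun_prop)

theorem torusLaplacian_torusLift {g : EuclideanSpace ℝ (Fin 3) → ℂ}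
    (hg : ∀ v, 1 ≤ ‖v‖ → g v = 0) (x : Torus3) :
    torusLaplacian (torusLift g) x = torusLift (fun v => -(Δ g) v) x := by
  unfold torusLaplacian
  rw [(InnerProductSpace.laplacian_congr_nhds (torusLift_eventuallyEq hg x)).eq_of_nhds]
  simp only [torusLift, InnerProductSpace.laplacian_eq_iteratedFDeriv_orthonormalBasis _
    (EuclideanSpace.basisFun (Fin 3) ℝ), iteratedFDeriv_comp_add_left (f := g), add_zero]

theorem torusRep_tendsto_zero : Tendsto torusRep (𝓝 0) (𝓝 0) := by
  intro s hs
  have h1 := isOpenQuotientMap_torusProj.isOpenMap.image_mem_nhds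
    (inter_mem hs (Metric.ball_mem_nhds (0 : EuclideanSpace ℝ (Fin 3)) one_pos))
  rw [torusProj_zero] at h1
  refine Filter.mem_map.mpr (mem_of_superset h1 ?_)
  rintro _ ⟨v, ⟨hvs, hv⟩, rfl⟩
  rw [Set.mem_preimage, torusRep_torusProj (mem_torusCube_of_norm_le ?_)]
  · exact hvs
  · rw [mem_ball_zero_iff] at hv
    linarith

theorem torusCoeff_torusLift {g : EuclideanSpace ℝ (Fin 3) → ℂ} (hg : ∀ v, 1 ≤ ‖v‖ → g v = 0)
    (hm : AEStronglyMeasurable g) (n : Fin 3 → ℤ) :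
    torusCoeff (torusLift g) n = ∫ v, g v * torusChar (-n) (torusProj v) := by
  have h1 : torusCoeff (torusLift g) n =
      ∫ x, (fun v => g v * torusChar (-n) (torusProj v)) (torusRep x) := by
    simp only [torusCoeff, torusLift, torusProj_torusRep]
  have h2 : AEStronglyMeasurable (fun v => g v * torusChar (-n) (torusProj v)) :=
    hm.mul ((continuous_torusChar _).comp continuous_torusProj).aestronglyMeasurable
  rw [h1, ← integral_map (f := fun v => g v * torusChar (-n) (torusProj v))
    measurable_torusRep.aemeasurable (by rw [measurePreserving_torusRep.map_eq]; exact h2.restrict),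
    measurePreserving_torusRep.map_eq]
  refine setIntegral_eq_integral_of_forall_compl_eq_zero fun v hv => ?_
  rw [hg, zero_mul]
  by_contra h
  exact hv (mem_torusCube_of_norm_le (by linarith))

end Representatives

/-! ### The Laplacian of a radial function -/

section Radial

/-- The Laplacian of a radial function `q(‖v‖²)` on `ℝ³` is `6 q' + 4 ‖v‖² q''`. -/
theorem laplacian_comp_norm_sq {q q₁ : ℝ → ℝ} {q₂ : ℝ} {v : EuclideanSpace ℝ (Fin 3)}
    (h₁ : ∀ᶠ s in 𝓝 (‖v‖ ^ 2), HasDerivAt q (q₁ s) s) (h₂ : HasDerivAt q₁ q₂ (‖v‖ ^ 2)) :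
    (Δ fun w : EuclideanSpace ℝ (Fin 3) => q (‖w‖ ^ 2)) v =
      6 * q₁ (‖v‖ ^ 2) + 4 * ‖v‖ ^ 2 * q₂ := by
  have hn : Tendsto (fun w : EuclideanSpace ℝ (Fin 3) => ‖w‖ ^ 2) (𝓝 v) (𝓝 (‖v‖ ^ 2)) :=
    (by fun_prop : Continuous fun w : EuclideanSpace ℝ (Fin 3) => ‖w‖ ^ 2).tendsto v
  have hsq : ∀ w : EuclideanSpace ℝ (Fin 3),
      HasFDerivAt (fun w : EuclideanSpace ℝ (Fin 3) => ‖w‖ ^ 2) ((2 : ℝ) • innerSL ℝ w) w :=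
    fun w => by
      have := (hasStrictFDerivAt_norm_sq w).hasFDerivAt
      rwa [← Nat.cast_smul_eq_nsmul ℝ, Nat.cast_ofNat] at this
  have hd1 : fderiv ℝ (fun w : EuclideanSpace ℝ (Fin 3) => q (‖w‖ ^ 2)) =ᶠ[𝓝 v]
      fun w => q₁ (‖w‖ ^ 2) • ((2 : ℝ) • innerSL ℝ w) := by
    filter_upwards [hn.eventually h₁] with w hw
    exact (hw.comp_hasFDerivAt w (hsq w)).fderiv
  have hlin : HasFDerivAt (fun w : EuclideanSpace ℝ (Fin 3) => (2 : ℝ) • innerSL ℝ w)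
      ((2 : ℝ) • (innerSL ℝ : EuclideanSpace ℝ (Fin 3) →L[ℝ] _)) v :=
    ((2 : ℝ) • (innerSL ℝ : EuclideanSpace ℝ (Fin 3) →L[ℝ] _)).hasFDerivAt
  have hd2 := (h₂.comp_hasFDerivAt v (hsq v)).smul hlin
  rw [InnerProductSpace.laplacian_eq_iteratedFDeriv_orthonormalBasis _
    (EuclideanSpace.basisFun (Fin 3) ℝ)]
  simp only [iteratedFDeriv_two_apply, hd1.fderiv_eq]
  have hd3 : fderiv ℝ (fun w : EuclideanSpace ℝ (Fin 3) =>
      q₁ (‖w‖ ^ 2) • ((2 : ℝ) • innerSL ℝ w)) v = _ := hd2.fderiv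
  have hnorm := EuclideanSpace.real_norm_sq_eq v
  rw [Fin.sum_univ_three] at hnorm
  rw [hd3, Fin.sum_univ_three]
  -- `innerSL ℝ` is used here as a linear, not a conjugate-linear, map
  have hself : ∀ w : EuclideanSpace ℝ (Fin 3),
      (innerSL ℝ : EuclideanSpace ℝ (Fin 3) →L[ℝ] EuclideanSpace ℝ (Fin 3) →L[ℝ] ℝ) w w =
        inner ℝ w w := fun _ => rfl
  simp [EuclideanSpace.inner_single_right, hself]
  linear_combination -4 * q₂ * hnorm

end Radial

/-! ### The truncated Newtonian potential -/

section Parametrix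

/-- A smooth cutoff, equal to `1` for `s ≤ 1/4` and to `0` for `s ≥ 1/2`; it is used at
`s = ‖v‖²`. -/
noncomputable def cutoff (s : ℝ) : ℝ := Real.smoothTransition (2 - 4 * s)

theorem contDiff_cutoff {k : ℕ∞} : ContDiff ℝ k cutoff :=
  Real.smoothTransition.contDiff.comp (by fun_prop)

theorem cutoff_nonneg (s : ℝ) : 0 ≤ cutoff s := Real.smoothTransition.nonneg _

theorem cutoff_of_le {s : ℝ} (h : s ≤ 1 / 4) : cutoff s = 1 :=
  Real.smoothTransition.one_of_one_le (by linarith)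

theorem cutoff_of_ge {s : ℝ} (h : 1 / 2 ≤ s) : cutoff s = 0 :=
  Real.smoothTransition.zero_of_nonpos (by linarith)

theorem contDiff_deriv_cutoff : ContDiff ℝ ∞ (deriv cutoff) :=
  (contDiff_infty_iff_deriv.mp contDiff_cutoff).2

theorem contDiff_deriv_deriv_cutoff : ContDiff ℝ ∞ (deriv (deriv cutoff)) :=
  (contDiff_infty_iff_deriv.mp contDiff_deriv_cutoff).2

theorem hasDerivAt_cutoff (s : ℝ) : HasDerivAt cutoff (deriv cutoff s) s :=
  ((contDiff_cutoff (k := ⊤)).differentiable (by simp) s).hasDerivAt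

theorem hasDerivAt_deriv_cutoff (s : ℝ) : HasDerivAt (deriv cutoff) (deriv (deriv cutoff) s) s :=
  (contDiff_deriv_cutoff.differentiable (by simp) s).hasDerivAt

theorem deriv_cutoff_eqOn_lt : Set.EqOn (deriv cutoff) 0 (Set.Iio (1 / 4)) := fun s hs => by
  have : cutoff =ᶠ[𝓝 s] fun _ => 1 := by
    filter_upwards [isOpen_Iio.mem_nhds hs] with t ht using cutoff_of_le (le_of_lt ht)
  rw [this.deriv_eq, deriv_const, Pi.zero_apply]

theorem deriv_cutoff_eqOn_gt : Set.EqOn (deriv cutoff) 0 (Set.Ioi (1 / 2)) := fun s hs => by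
  have : cutoff =ᶠ[𝓝 s] fun _ => 0 := by
    filter_upwards [isOpen_Ioi.mem_nhds hs] with t ht using cutoff_of_ge (le_of_lt ht)
  rw [this.deriv_eq, deriv_const, Pi.zero_apply]

theorem deriv_deriv_cutoff_eqOn_lt : Set.EqOn (deriv (deriv cutoff)) 0 (Set.Iio (1 / 4)) :=
  fun s hs => by
    have : deriv cutoff =ᶠ[𝓝 s] fun _ => 0 := by
      filter_upwards [isOpen_Iio.mem_nhds hs] with t ht using deriv_cutoff_eqOn_lt ht
    rw [this.deriv_eq, deriv_const, Pi.zero_apply]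

theorem deriv_deriv_cutoff_eqOn_gt : Set.EqOn (deriv (deriv cutoff)) 0 (Set.Ioi (1 / 2)) :=
  fun s hs => by
    have : deriv cutoff =ᶠ[𝓝 s] fun _ => 0 := by
      filter_upwards [isOpen_Ioi.mem_nhds hs] with t ht using deriv_cutoff_eqOn_gt ht
    rw [this.deriv_eq, deriv_const, Pi.zero_apply]

/-- The truncated and regularised Newtonian potential `χ(‖v‖²) (‖v‖² + δ)^{-1/2}` on `ℝ³`. For
`δ = 0` it is `1 / ‖v‖` near the origin, with the value `0` at the origin itself. -/
noncomputable def parametrix (δ : ℝ) (v : EuclideanSpace ℝ (Fin 3)) : ℝ :=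
  cutoff (‖v‖ ^ 2) * (‖v‖ ^ 2 + δ) ^ (-(1 / 2) : ℝ)

/-- The part of `-Δ (parametrix δ)` that concentrates at the origin as `δ → 0`. -/
noncomputable def parametrixPeak (δ : ℝ) (v : EuclideanSpace ℝ (Fin 3)) : ℝ :=
  3 * δ * cutoff (‖v‖ ^ 2) * (‖v‖ ^ 2 + δ) ^ (-(5 / 2) : ℝ)

/-- The part of `Δ (parametrix δ)` that comes from differentiating the cutoff. It lives in the shell
`1/4 ≤ ‖v‖² ≤ 1/2` and stays smooth for `δ = 0`. -/
noncomputable def parametrixError (δ : ℝ) (v : EuclideanSpace ℝ (Fin 3)) : ℝ :=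
  4 * ‖v‖ ^ 2 * deriv (deriv cutoff) (‖v‖ ^ 2) * (‖v‖ ^ 2 + δ) ^ (-(1 / 2) : ℝ) +
    deriv cutoff (‖v‖ ^ 2) * (6 * (‖v‖ ^ 2 + δ) ^ (-(1 / 2) : ℝ) -
      4 * ‖v‖ ^ 2 * (‖v‖ ^ 2 + δ) ^ (-(3 / 2) : ℝ))

theorem half_lt_norm_sq {v : EuclideanSpace ℝ (Fin 3)} (hv : 1 ≤ ‖v‖) : 1 / 2 < ‖v‖ ^ 2 := by
  nlinarith

theorem parametrix_of_one_le {δ : ℝ} {v : EuclideanSpace ℝ (Fin 3)} (hv : 1 ≤ ‖v‖) :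
    parametrix δ v = 0 := by
  rw [parametrix, cutoff_of_ge (half_lt_norm_sq hv).le, zero_mul]

theorem parametrixPeak_of_one_le {δ : ℝ} {v : EuclideanSpace ℝ (Fin 3)} (hv : 1 ≤ ‖v‖) :
    parametrixPeak δ v = 0 := by
  rw [parametrixPeak, cutoff_of_ge (half_lt_norm_sq hv).le, mul_zero, zero_mul]

theorem parametrixError_of_one_le {δ : ℝ} {v : EuclideanSpace ℝ (Fin 3)} (hv : 1 ≤ ‖v‖) :
    parametrixError δ v = 0 := by
  rw [parametrixError, deriv_deriv_cutoff_eqOn_gt (half_lt_norm_sq hv),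
    deriv_cutoff_eqOn_gt (half_lt_norm_sq hv)]
  simp

theorem parametrixError_of_lt {δ : ℝ} {v : EuclideanSpace ℝ (Fin 3)} (hv : ‖v‖ ^ 2 < 1 / 4) :
    parametrixError δ v = 0 := by
  rw [parametrixError, deriv_deriv_cutoff_eqOn_lt hv, deriv_cutoff_eqOn_lt hv]
  simp

theorem contDiffAt_norm_sq_add_rpow {δ : ℝ} {v : EuclideanSpace ℝ (Fin 3)} (h : 0 < ‖v‖ ^ 2 + δ)
    (p : ℝ) : ContDiffAt ℝ ∞ (fun v : EuclideanSpace ℝ (Fin 3) => (‖v‖ ^ 2 + δ) ^ p) v :=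
  ((contDiff_norm_sq ℝ).contDiffAt.add contDiffAt_const).rpow_const_of_ne h.ne'

theorem contDiffAt_parametrix {δ : ℝ} {v : EuclideanSpace ℝ (Fin 3)} (h : 0 < ‖v‖ ^ 2 + δ) :
    ContDiffAt ℝ ∞ (parametrix δ) v :=
  ((contDiff_cutoff (k := ⊤)).comp (contDiff_norm_sq ℝ)).contDiffAt.mul
    (contDiffAt_norm_sq_add_rpow h _)

theorem contDiffAt_parametrixPeak {δ : ℝ} {v : EuclideanSpace ℝ (Fin 3)} (h : 0 < ‖v‖ ^ 2 + δ) :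
    ContDiffAt ℝ ∞ (parametrixPeak δ) v :=
  (contDiffAt_const.mul ((contDiff_cutoff (k := ⊤)).comp (contDiff_norm_sq ℝ)).contDiffAt).mul
    (contDiffAt_norm_sq_add_rpow h _)

theorem contDiff_parametrixError {δ : ℝ} (hδ : 0 ≤ δ) : ContDiff ℝ ∞ (parametrixError δ) := by
  refine contDiff_iff_contDiffAt.mpr fun v => ?_
  by_cases hv : v = 0
  · have : parametrixError δ =ᶠ[𝓝 v] fun _ => 0 := by
      have h1 : IsOpen {w : EuclideanSpace ℝ (Fin 3) | ‖w‖ ^ 2 < 1 / 4} :=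
        isOpen_lt (by fun_prop) continuous_const
      filter_upwards [h1.mem_nhds (by simp [hv])] with w hw using parametrixError_of_lt hw
    exact contDiffAt_const.congr_of_eventuallyEq this
  · have h : 0 < ‖v‖ ^ 2 + δ := by
      have := norm_pos_iff.mpr hv
      positivity
    have hs : ContDiffAt ℝ ∞ (fun v : EuclideanSpace ℝ (Fin 3) => ‖v‖ ^ 2) v :=
      (contDiff_norm_sq ℝ).contDiffAt
    have h1 := (contDiff_deriv_cutoff.comp
      (contDiff_norm_sq ℝ (E := EuclideanSpace ℝ (Fin 3)))).contDiffAt (x := v)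
    have h2 := (contDiff_deriv_deriv_cutoff.comp
      (contDiff_norm_sq ℝ (E := EuclideanSpace ℝ (Fin 3)))).contDiffAt (x := v)
    have h3 := contDiffAt_norm_sq_add_rpow h (-(1 / 2))
    have h4 := contDiffAt_norm_sq_add_rpow h (-(3 / 2))
    exact (((contDiffAt_const.mul hs).mul h2).mul h3).add
      (h1.mul ((contDiffAt_const.mul h3).sub ((contDiffAt_const.mul hs).mul h4)))

/-- The terms in which the cutoff is not differentiated add up to `parametrixPeak`; without the
cutoff this is `-Δ (‖v‖² + δ)^{-1/2} = 3 δ (‖v‖² + δ)^{-5/2}`. -/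
theorem laplacian_parametrix {δ : ℝ} (hδ : 0 < δ) (v : EuclideanSpace ℝ (Fin 3)) :
    (Δ (parametrix δ)) v = parametrixError δ v - parametrixPeak δ v := by
  set s := ‖v‖ ^ 2 with hs
  have hpos : 0 < s + δ := by positivity
  have hrpow : ∀ (p t : ℝ), 0 < t + δ →
      HasDerivAt (fun t : ℝ => (t + δ) ^ p) (p * (t + δ) ^ (p - 1)) t := fun p t ht => by
    simpa using ((hasDerivAt_id t).add_const δ).rpow_const (p := p) (Or.inl ht.ne')
  have h1 : ∀ᶠ t in 𝓝 s, HasDerivAt (fun t => cutoff t * (t + δ) ^ (-(1 / 2) : ℝ))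
      (deriv cutoff t * (t + δ) ^ (-(1 / 2) : ℝ) +
        cutoff t * (-(1 / 2) * (t + δ) ^ (-(1 / 2) - 1 : ℝ))) t := by
    have : Set.Ioi (-δ) ∈ 𝓝 s := isOpen_Ioi.mem_nhds (by rw [Set.mem_Ioi]; linarith)
    filter_upwards [this] with t ht
    exact (hasDerivAt_cutoff t).mul (hrpow _ t (by rw [Set.mem_Ioi] at ht; linarith))
  have h2 := ((hasDerivAt_deriv_cutoff s).mul (hrpow (-(1 / 2)) s hpos)).add
    ((hasDerivAt_cutoff s).mul ((hrpow (-(1 / 2) - 1) s hpos).const_mul (-(1 / 2))))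
  have h3 := laplacian_comp_norm_sq h1 h2
  have e1 : (-(1 / 2) - 1 : ℝ) = -(3 / 2) := by norm_num
  have e2 : (-(1 / 2) - 1 - 1 : ℝ) = -(5 / 2) := by norm_num
  have e3 : (s + δ) ^ (-(3 / 2) : ℝ) = (s + δ) * (s + δ) ^ (-(5 / 2) : ℝ) := by
    rw [mul_comm, ← Real.rpow_add_one hpos.ne']
    norm_num
  rw [e2] at h3
  simp only [e1, ← hs] at h3
  refine h3.trans ?_
  simp only [parametrixError, parametrixPeak, ← hs]
  rw [e3]
  ring

end Parametrix

/-! ### Fourier coefficients of the truncated Newtonian potential -/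

section Limits

theorem measurable_parametrix (δ : ℝ) : Measurable (parametrix δ) := by
  have h : Measurable cutoff := (contDiff_cutoff (k := 0)).continuous.measurable
  unfold parametrix
  fun_prop

/-- `1 / ‖v‖` is square integrable near the origin of `ℝ³`: in polar coordinates the factor `r²`
cancels the singularity. -/
theorem memLp_parametrix : MemLp (parametrix 0) 2 volume := by
  rw [memLp_two_iff_integrable_sq (measurable_parametrix 0).aestronglyMeasurable]
  have h := (integrable_fun_norm_addHaar (E := EuclideanSpace ℝ (Fin 3)) volume
    (f := fun r => (cutoff (r ^ 2) * (r ^ 2 + 0) ^ (-(1 / 2) : ℝ)) ^ 2)).mpr ?_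
  · exact h
  have hc : Continuous fun r : ℝ => cutoff (r ^ 2) ^ 2 :=
    ((contDiff_cutoff (k := 0)).continuous.comp (by fun_prop)).pow 2
  have hsupp : HasCompactSupport fun r : ℝ => cutoff (r ^ 2) ^ 2 := by
    refine HasCompactSupport.intro (K := Set.Icc (-1) 1) isCompact_Icc fun r hr => ?_
    have : 1 / 2 ≤ r ^ 2 := by
      by_contra hlt
      exact hr (abs_le.mp (by nlinarith [sq_abs r, abs_nonneg r]))
    rw [cutoff_of_ge this]
    simp
  refine (hc.integrable_of_hasCompactSupport hsupp).integrableOn.congr_fun (fun r hr => ?_)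
    measurableSet_Ioi
  have hr' : (0 : ℝ) < r := hr
  have : (r ^ 2 + 0) ^ (-(1 / 2) : ℝ) = r⁻¹ := by
    rw [add_zero, ← Real.rpow_natCast r 2, ← Real.rpow_mul hr'.le]
    norm_num
    exact Real.rpow_neg_one r
  simp only [finrank_euclideanSpace, Fintype.card_fin, smul_eq_mul, this]
  field_simp
  norm_num
  ring

theorem memLp_torusLift_parametrix :
    MemLp (torusLift fun v => ((parametrix 0 v : ℝ) : ℂ)) 2 volume :=
  MemLp.comp_measurePreserving (g := fun v => ((parametrix 0 v : ℝ) : ℂ))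
    (memLp_parametrix.ofReal.restrict torusCube) measurePreserving_torusRep

theorem ae_torusRep_ne_zero : ∀ᵐ x : Torus3, torusRep x ≠ 0 := by
  have h : ∀ᵐ v ∂(volume.restrict torusCube), v ≠ (0 : EuclideanSpace ℝ (Fin 3)) :=
    ae_restrict_of_ae (measure_eq_zero_iff_ae_notMem.mp (measure_singleton _))
  exact measurePreserving_torusRep.quasiMeasurePreserving.ae h

theorem tendsto_norm_sq_add_rpow {v : EuclideanSpace ℝ (Fin 3)} (hv : v ≠ 0) (p : ℝ) :
    Tendsto (fun δ : ℝ => (‖v‖ ^ 2 + δ) ^ p) (𝓝[>] 0) (𝓝 ((‖v‖ ^ 2 + 0) ^ p)) := by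
  have h : ‖v‖ ^ 2 + 0 ≠ 0 := by simpa using hv
  exact ((continuousAt_const.add continuousAt_id).rpow_const (Or.inl h)).tendsto.mono_left
    nhdsWithin_le_nhds

/-- Dominated convergence, with `parametrix 0` itself as the dominating function. -/
theorem tendsto_torusCoeff_parametrix (n : Fin 3 → ℤ) :
    Tendsto (fun δ => torusCoeff (torusLift fun v => ((parametrix δ v : ℝ) : ℂ)) n) (𝓝[>] 0)
      (𝓝 (torusCoeff (torusLift fun v => ((parametrix 0 v : ℝ) : ℂ)) n)) := by
  have hint := (memLp_torusLift_parametrix.integrable one_le_two).norm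
  refine tendsto_integral_filter_of_dominated_convergence _ ?_ ?_ hint ?_
  · refine Eventually.of_forall fun δ => AEStronglyMeasurable.mul ?_
      (continuous_torusChar _).aestronglyMeasurable
    exact (Complex.measurable_ofReal.comp
      ((measurable_parametrix δ).comp measurable_torusRep)).aestronglyMeasurable
  · filter_upwards [self_mem_nhdsWithin] with δ hδ
    filter_upwards [ae_torusRep_ne_zero] with x hx
    have hδ' : (0 : ℝ) < δ := hδ
    have hn : 0 < ‖torusRep x‖ := norm_pos_iff.mpr hx
    simp only [torusLift, norm_mul, norm_torusChar, mul_one, Complex.norm_real, parametrix,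
      Real.norm_of_nonneg (cutoff_nonneg _)]
    refine mul_le_mul_of_nonneg_left ?_ (cutoff_nonneg _)
    rw [Real.norm_of_nonneg (by positivity), Real.norm_of_nonneg (by positivity)]
    exact Real.rpow_le_rpow_of_nonpos (by positivity) (by linarith) (by norm_num)
  · filter_upwards [ae_torusRep_ne_zero] with x hx
    refine Tendsto.mul_const _ ?_
    exact (Complex.continuous_ofReal.tendsto _).comp
      ((tendsto_norm_sq_add_rpow hx _).const_mul _)

theorem exists_bound_parametrixError :
    ∃ C, ∀ δ, 0 ≤ δ → ∀ v, |parametrixError δ v| ≤ C := by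
  obtain ⟨A, hA⟩ := (isCompact_Icc (a := (1 / 4 : ℝ)) (b := 1 / 2)).exists_bound_of_continuousOn
    contDiff_deriv_cutoff.continuous.continuousOn
  obtain ⟨B, hB⟩ := (isCompact_Icc (a := (1 / 4 : ℝ)) (b := 1 / 2)).exists_bound_of_continuousOn
    contDiff_deriv_deriv_cutoff.continuous.continuousOn
  have hA0 : 0 ≤ A := (norm_nonneg _).trans (hA (1 / 4) (by norm_num))
  have hB0 : 0 ≤ B := (norm_nonneg _).trans (hB (1 / 4) (by norm_num))
  -- on the shell `1/4 ≤ s ≤ 1/2` one has `4 s ≤ 2`, `(s + δ)^{-1/2} ≤ 2`, `(s + δ)^{-3/2} ≤ 8`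
  refine ⟨2 * B * 2 + A * (6 * 2 + 2 * 8), fun δ hδ v => ?_⟩
  set s := ‖v‖ ^ 2 with hs
  by_cases h1 : s < 1 / 4
  · rw [parametrixError_of_lt h1, abs_zero]; positivity
  by_cases h2 : 1 / 2 < s
  · rw [parametrixError, ← hs, deriv_deriv_cutoff_eqOn_gt h2, deriv_cutoff_eqOn_gt h2]
    simp only [Pi.zero_apply, mul_zero, zero_mul, add_zero, abs_zero]
    positivity
  have hmem : s ∈ Set.Icc (1 / 4 : ℝ) (1 / 2) := ⟨not_lt.mp h1, not_lt.mp h2⟩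
  have h4 : (1 / 4 : ℝ) ≤ s + δ := by linarith [hmem.1]
  have hsqrt : ∀ p : ℝ, (1 / 4 : ℝ) ^ p = 2 ^ (-(2 * p)) := fun p => by
    rw [show (1 / 4 : ℝ) = 2 ^ (-2 : ℝ) by rw [Real.rpow_neg two_pos.le]; norm_num,
      ← Real.rpow_mul two_pos.le]
    congr 1; ring
  have hX : (s + δ) ^ (-(1 / 2) : ℝ) ≤ 2 := by
    refine (Real.rpow_le_rpow_of_nonpos (by norm_num) h4 (by norm_num)).trans_eq ?_
    rw [hsqrt]; norm_num
  have hY : (s + δ) ^ (-(3 / 2) : ℝ) ≤ 8 := by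
    refine (Real.rpow_le_rpow_of_nonpos (by norm_num) h4 (by norm_num)).trans_eq ?_
    rw [hsqrt]; norm_num
  have hX0 : 0 ≤ (s + δ) ^ (-(1 / 2) : ℝ) := by positivity
  have hY0 : 0 ≤ (s + δ) ^ (-(3 / 2) : ℝ) := by positivity
  have hs0 : 0 ≤ 4 * s := by positivity
  have hs2 : 4 * s ≤ 2 := by linarith [hmem.2]
  rw [parametrixError, ← hs]
  refine (abs_add_le _ _).trans (add_le_add ?_ ?_)
  · rw [abs_mul, abs_mul, abs_of_nonneg hs0, abs_of_nonneg hX0]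
    have := hB s hmem
    rw [Real.norm_eq_abs] at this
    gcongr
  · rw [abs_mul]
    have := hA s hmem
    rw [Real.norm_eq_abs] at this
    refine mul_le_mul this ?_ (abs_nonneg _) hA0
    refine (abs_sub _ _).trans (add_le_add ?_ ?_)
    · rw [abs_of_nonneg (by positivity)]; gcongr
    · rw [abs_of_nonneg (by positivity)]; gcongr

theorem tendsto_torusCoeff_parametrixError (n : Fin 3 → ℤ) :
    Tendsto (fun δ => torusCoeff (torusLift fun v => ((parametrixError δ v : ℝ) : ℂ)) n) (𝓝[>] 0)
      (𝓝 (torusCoeff (torusLift fun v => ((parametrixError 0 v : ℝ) : ℂ)) n)) := by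
  obtain ⟨C, hC⟩ := exists_bound_parametrixError
  refine tendsto_integral_filter_of_dominated_convergence (fun _ => C) ?_ ?_
    (integrable_const C) ?_
  · filter_upwards [self_mem_nhdsWithin] with δ hδ
    refine AEStronglyMeasurable.mul ?_ (continuous_torusChar _).aestronglyMeasurable
    exact (Complex.measurable_ofReal.comp ((contDiff_parametrixError
      (le_of_lt hδ)).continuous.measurable.comp measurable_torusRep)).aestronglyMeasurable
  · filter_upwards [self_mem_nhdsWithin] with δ hδ
    refine Eventually.of_forall fun x => ?_
    rw [norm_mul, norm_torusChar, mul_one, torusLift, Complex.norm_real]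
    exact hC δ (le_of_lt hδ) _
  · filter_upwards [ae_torusRep_ne_zero] with x hx
    refine Tendsto.mul_const _ ((Complex.continuous_ofReal.tendsto _).comp ?_)
    exact ((tendsto_norm_sq_add_rpow hx _).const_mul _).add
      ((((tendsto_norm_sq_add_rpow hx _).const_mul _).sub
        ((tendsto_norm_sq_add_rpow hx _).const_mul _)).const_mul _)

/-- The profile `3 (1 + ‖v‖²)^{-5/2}`, which is `-Δ` of `(1 + ‖v‖²)^{-1/2}`. -/
noncomputable def newtonProfile (v : EuclideanSpace ℝ (Fin 3)) : ℝ :=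
  3 * (1 + ‖v‖ ^ 2) ^ (-(5 / 2) : ℝ)

/-- The total mass of the profile; its value is `4π`, but only its positivity matters. -/
noncomputable def newtonMass : ℝ := ∫ v, newtonProfile v

theorem newtonProfile_pos (v : EuclideanSpace ℝ (Fin 3)) : 0 < newtonProfile v := by
  unfold newtonProfile
  positivity

theorem integrable_newtonProfile : Integrable newtonProfile := by
  have h := integrable_rpow_neg_one_add_norm_sq (E := EuclideanSpace ℝ (Fin 3)) (μ := volume)
    (r := 5) (by norm_num)
  refine (h.const_mul 3).congr (Eventually.of_forall fun v => ?_)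
  simp only [newtonProfile, neg_div]

theorem newtonMass_pos : 0 < newtonMass := by
  refine (integral_pos_iff_support_of_nonneg (fun v => (newtonProfile_pos v).le)
    integrable_newtonProfile).mpr ?_
  have : Function.support newtonProfile = Set.univ := by
    ext v; simp [(newtonProfile_pos v).ne']
  rw [this]
  exact Measure.measure_univ_pos.mpr (NeZero.ne _)

theorem tendsto_norm_pow_mul_newtonProfile :
    Tendsto (fun v : EuclideanSpace ℝ (Fin 3) => ‖v‖ ^ 3 * (newtonProfile v / newtonMass))
      (Bornology.cobounded _) (𝓝 0) := by
  have h1 : Tendsto (fun v : EuclideanSpace ℝ (Fin 3) => 3 / newtonMass * ‖v‖ ^ (-2 : ℝ))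
      (Bornology.cobounded _) (𝓝 0) := by
    have := ((tendsto_rpow_neg_atTop two_pos).comp
      (tendsto_norm_cobounded_atTop (E := EuclideanSpace ℝ (Fin 3)))).const_mul (3 / newtonMass)
    simpa using this
  have hm := newtonMass_pos
  refine squeeze_zero' (Eventually.of_forall fun v => ?_) ?_ h1
  · have := newtonProfile_pos v
    positivity
  · filter_upwards [tendsto_norm_cobounded_atTop.eventually (eventually_gt_atTop (0 : ℝ))] with v hv
    have h2 : (1 + ‖v‖ ^ 2) ^ (-(5 / 2) : ℝ) ≤ ‖v‖ ^ (-5 : ℝ) := by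
      have : ‖v‖ ^ (-5 : ℝ) = (‖v‖ ^ 2) ^ (-(5 / 2) : ℝ) := by
        rw [← Real.rpow_natCast ‖v‖ 2, ← Real.rpow_mul hv.le]
        norm_num
      rw [this]
      exact Real.rpow_le_rpow_of_nonpos (by positivity) (by linarith) (by norm_num)
    have h3 : ‖v‖ ^ (-2 : ℝ) = ‖v‖ ^ 3 * ‖v‖ ^ (-5 : ℝ) := by
      rw [← Real.rpow_natCast ‖v‖ 3, ← Real.rpow_add hv]
      norm_num
    rw [h3, newtonProfile]
    calc ‖v‖ ^ 3 * (3 * (1 + ‖v‖ ^ 2) ^ (-(5 / 2) : ℝ) / newtonMass)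
        = 3 / newtonMass * (‖v‖ ^ 3 * (1 + ‖v‖ ^ 2) ^ (-(5 / 2) : ℝ)) := by ring
      _ ≤ _ := by gcongr

theorem parametrixPeak_eq {c : ℝ} (hc : 0 < c) (v : EuclideanSpace ℝ (Fin 3)) :
    parametrixPeak (1 / c ^ 2) v = c ^ 3 * newtonProfile (c • v) * cutoff (‖v‖ ^ 2) := by
  have h1 : ‖v‖ ^ 2 + 1 / c ^ 2 = c ^ (-2 : ℝ) * (1 + ‖c • v‖ ^ 2) := by
    rw [norm_smul, Real.norm_of_nonneg hc.le, Real.rpow_neg hc.le, Real.rpow_two]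
    field_simp
    ring
  have h2 : (c ^ (-2 : ℝ)) ^ (-(5 / 2) : ℝ) = c ^ 5 := by
    rw [← Real.rpow_mul hc.le, ← Real.rpow_natCast c 5]
    norm_num
  rw [parametrixPeak, newtonProfile, h1, Real.mul_rpow (by positivity) (by positivity), h2]
  field_simp

/-- The peak is the rescaled profile `c³ newtonProfile (c v)` times a cutoff, so it converges to a
multiple of the Dirac mass at the origin. -/
theorem tendsto_torusCoeff_parametrixPeak (n : Fin 3 → ℤ) :
    Tendsto (fun c : ℝ => torusCoeff
      (torusLift fun v => ((parametrixPeak (1 / c ^ 2) v : ℝ) : ℂ)) n) atTop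
      (𝓝 (newtonMass : ℂ)) := by
  have hm := newtonMass_pos
  set g : EuclideanSpace ℝ (Fin 3) → ℂ := fun v =>
    (cutoff (‖v‖ ^ 2) : ℂ) * torusChar (-n) (torusProj v) with hg
  have hgc : Continuous g :=
    (Complex.continuous_ofReal.comp ((contDiff_cutoff (k := 0)).continuous.comp
      (by fun_prop))).mul ((continuous_torusChar _).comp continuous_torusProj)
  have hgi : Integrable g := by
    refine hgc.integrable_of_hasCompactSupport
      (HasCompactSupport.intro (isCompact_closedBall 0 1) fun v hv => ?_)
    have : 1 ≤ ‖v‖ := by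
      rw [mem_closedBall_zero_iff, not_le] at hv
      exact hv.le
    simp [hg, cutoff_of_ge (half_lt_norm_sq this).le]
  have h1 := tendsto_integral_comp_smul_smul_of_integrable (μ := volume)
    (φ := fun v => newtonProfile v / newtonMass)
    (fun v => div_nonneg (newtonProfile_pos v).le hm.le)
    (by rw [integral_div]; exact div_self hm.ne')
    (by simpa using tendsto_norm_pow_mul_newtonProfile) hgi hgc.continuousAt
  have hg0 : g 0 = 1 := by
    simp [hg, torusProj_zero, torusChar_apply_zero, cutoff_of_le]
  rw [hg0] at h1
  have h2 := h1.const_mul (newtonMass : ℂ)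
  rw [mul_one] at h2
  refine h2.congr' ?_
  filter_upwards [eventually_gt_atTop 0] with c hc
  rw [torusCoeff_torusLift (fun v hv => by rw [parametrixPeak_of_one_le hv, Complex.ofReal_zero])]
  · rw [← integral_const_mul]
    congr 1
    ext v
    rw [parametrixPeak_eq hc]
    simp only [hg, finrank_euclideanSpace, Fintype.card_fin, Complex.real_smul]
    have : (newtonMass : ℂ) ≠ 0 := Complex.ofReal_ne_zero.mpr hm.ne'
    push_cast
    field_simp
  · have : Continuous (parametrixPeak (1 / c ^ 2)) := continuous_iff_continuousAt.mpr fun v =>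
      (contDiffAt_parametrixPeak (by positivity)).continuousAt
    exact (Complex.continuous_ofReal.comp this).aestronglyMeasurable

theorem torusSmooth_torusLift_ofReal {g : EuclideanSpace ℝ (Fin 3) → ℝ}
    (hg : ∀ v, 1 ≤ ‖v‖ → g v = 0) (h : ∀ v, ContDiffAt ℝ ∞ g v) :
    TorusSmooth (torusLift fun v => ((g v : ℝ) : ℂ)) := fun _ =>
  torusSmoothAt_torusLift (fun v hv => by rw [hg v hv, Complex.ofReal_zero])
    (Complex.ofRealCLM.contDiff.contDiffAt.comp _ (h _))

/-- The regularised form of the equation satisfied by the parametrix. -/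
theorem torusEigenvalue_mul_torusCoeff_parametrix_of_pos {δ : ℝ} (hδ : 0 < δ) (n : Fin 3 → ℤ) :
    torusEigenvalue n * torusCoeff (torusLift fun v => ((parametrix δ v : ℝ) : ℂ)) n =
      torusCoeff (torusLift fun v => ((parametrixPeak δ v : ℝ) : ℂ)) n -
        torusCoeff (torusLift fun v => ((parametrixError δ v : ℝ) : ℂ)) n := by
  have hpos : ∀ v : EuclideanSpace ℝ (Fin 3), 0 < ‖v‖ ^ 2 + δ := fun v => by positivity
  have hs1 := torusSmooth_torusLift_ofReal (fun _ => parametrix_of_one_le)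
    fun v => contDiffAt_parametrix (hpos v)
  have hs2 := torusSmooth_torusLift_ofReal (fun _ => parametrixPeak_of_one_le)
    fun v => contDiffAt_parametrixPeak (hpos v)
  have hs3 := torusSmooth_torusLift_ofReal (fun _ => parametrixError_of_one_le)
    fun v => (contDiff_parametrixError hδ.le).contDiffAt
  rw [← torusCoeff_torusLaplacian hs1,
    ← torusCoeff_sub hs2.continuous.integrable_torus hs3.continuous.integrable_torus]
  congr 1
  ext x
  rw [torusLaplacian_torusLift fun v hv => by rw [parametrix_of_one_le hv, Complex.ofReal_zero]]
  simp only [torusLift]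
  have hl := ((contDiffAt_parametrix (hpos (torusRep x))).of_le
    (WithTop.coe_le_coe.mpr le_top)).laplacian_CLM_comp_left (l := Complex.ofRealCLM)
  have hl' : (Δ fun v => ((parametrix δ v : ℝ) : ℂ)) (torusRep x) =
    (((Δ (parametrix δ)) (torusRep x) : ℝ) : ℂ) := hl
  rw [hl', laplacian_parametrix hδ]
  push_cast
  ring

/-- The truncated Newtonian potential `P` satisfies `-ΔP = newtonMass · δ₀ - E` on the torus, with
`E` smooth, in terms of Fourier coefficients. -/
theorem torusEigenvalue_mul_torusCoeff_parametrix (n : Fin 3 → ℤ) :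
    torusEigenvalue n * torusCoeff (torusLift fun v => ((parametrix 0 v : ℝ) : ℂ)) n =
      newtonMass - torusCoeff (torusLift fun v => ((parametrixError 0 v : ℝ) : ℂ)) n := by
  -- `δ = 1 / c²` with `c → ∞` is the parameter of the rescaled profile in `parametrixPeak_eq`
  have hδ : Tendsto (fun c : ℝ => 1 / c ^ 2) atTop (𝓝[>] 0) := by
    refine tendsto_nhdsWithin_iff.mpr ⟨?_, ?_⟩
    · simpa [Function.comp_def] using
        tendsto_inv_atTop_zero.comp (tendsto_pow_atTop (α := ℝ) two_ne_zero)
    · filter_upwards [eventually_gt_atTop 0] with c hc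
      exact Set.mem_Ioi.mpr (by positivity)
  have h1 := ((tendsto_torusCoeff_parametrix n).comp hδ).const_mul (torusEigenvalue n)
  have h2 := (tendsto_torusCoeff_parametrixPeak n).sub
    ((tendsto_torusCoeff_parametrixError n).comp hδ)
  refine tendsto_nhds_unique (h1.congr' ?_) h2
  filter_upwards [eventually_gt_atTop 0] with c hc
  exact torusEigenvalue_mul_torusCoeff_parametrix_of_pos (by positivity) n

end Limits

/-! ### Fundamental solutions in terms of Fourier coefficients -/

section FundamentalSolution

theorem torusEigenvalue_eq_intCast (n : Fin 3 → ℤ) :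
    torusEigenvalue n = ((∑ i, n i ^ 2 : ℤ) : ℂ) := by
  simp [torusEigenvalue]

theorem torusEigenvalue_eq_zero_iff {n : Fin 3 → ℤ} : torusEigenvalue n = 0 ↔ n = 0 := by
  rw [torusEigenvalue_eq_intCast, Int.cast_eq_zero,
    Finset.sum_eq_zero_iff_of_nonneg fun i _ => sq_nonneg _]
  simp [funext_iff]

theorem torusEigenvalue_neg (n : Fin 3 → ℤ) : torusEigenvalue (-n) = torusEigenvalue n := by
  simp [torusEigenvalue]

theorem conj_torusEigenvalue (n : Fin 3 → ℤ) :
    (starRingEnd ℂ) (torusEigenvalue n) = torusEigenvalue n := by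
  simp [torusEigenvalue]

theorem norm_torusEigenvalue_inv_le (n : Fin 3 → ℤ) : ‖(torusEigenvalue n)⁻¹‖ ≤ 1 := by
  by_cases h : torusEigenvalue n = 0
  · simp [h]
  · rw [norm_inv]
    refine inv_le_one_of_one_le₀ ?_
    rw [torusEigenvalue_eq_intCast] at h ⊢
    rw [Complex.norm_intCast, ← Int.cast_abs]
    exact_mod_cast Int.one_le_abs (Int.cast_ne_zero.mp h)

/-- An integrable function with Fourier coefficients `‖n‖⁻²`, and `0` for `n = 0`, is a fundamental
solution. The junk value `0⁻¹ = 0` covers the case `n = 0`. -/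
theorem isTorusFundamentalSolution_of_torusCoeff {φ : Torus3 → ℂ} (hφ : Integrable φ)
    (h : ∀ n, torusCoeff φ n = (torusEigenvalue n)⁻¹) : IsTorusFundamentalSolution φ := by
  have key : ∀ f : Torus3 → ℂ, TorusSmooth f →
      RapidDecay (fun n => torusCoeff f n * (8 * (Real.pi : ℂ) ^ 3)⁻¹ * torusCoeff φ n) ∧
      torusConv φ f = torusSeries
        fun n => torusCoeff f n * (8 * (Real.pi : ℂ) ^ 3)⁻¹ * torusCoeff φ n := by
    intro f hf
    have hc : RapidDecay fun n => torusCoeff f n * (8 * (Real.pi : ℂ) ^ 3)⁻¹ :=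
      hf.rapidDecay.mul_bounded fun _ => le_rfl
    refine ⟨hc.mul_bounded fun n => norm_torusCoeff_le n, ?_⟩
    conv_lhs => rw [hf.eq_torusSeries]
    exact torusConv_torusSeries hφ hc.summable_norm
  refine ⟨hφ, ?_, fun f hf _ => ?_, fun f hf h0 x => ?_⟩
  · rw [← torusCoeff_zero, h, torusEigenvalue_eq_zero_iff.mpr rfl, inv_zero]
  · rw [(key f hf).2]
    exact (key f hf).1.torusSmooth
  · have hsm : TorusSmooth (torusConv φ f) := by
      rw [(key f hf).2]
      exact (key f hf).1.torusSmooth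
    refine congrFun ((continuous_torusLaplacian hsm).eq_of_torusCoeff_eq hf.continuous
      fun n => ?_) x
    rw [torusCoeff_torusLaplacian hsm, (key f hf).2,
      torusCoeff_torusSeries (key f hf).1.summable_norm, h]
    by_cases hn : n = 0
    · rw [hn, torusCoeff_zero, h0]; ring
    · have h1 := mt torusEigenvalue_eq_zero_iff.mp hn
      have h2 := pi_cube_ne_zero
      field_simp

/-- The equation for `f = e^{i n·x}` determines the `n`-th coefficient of a fundamental solution. -/
theorem IsTorusFundamentalSolution.torusCoeff_eq {ψ : Torus3 → ℂ}
    (hψ : IsTorusFundamentalSolution ψ) (n : Fin 3 → ℤ) :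
    torusCoeff ψ n = (torusEigenvalue n)⁻¹ := by
  by_cases hn : n = 0
  · rw [hn, torusCoeff_zero, hψ.integral_eq_zero, torusEigenvalue_eq_zero_iff.mpr rfl, inv_zero]
  · have h0 : ∫ x, torusChar n x = 0 := by rw [integral_torusChar, if_neg hn]
    have h1 := hψ.smooth_conv _ (torusSmooth_torusChar n) h0
    have h2 := torusCoeff_torusLaplacian h1 n
    rw [funext (hψ.laplacian_conv _ (torusSmooth_torusChar n) h0),
      funext (torusConv_torusChar ψ n), torusCoeff_const_mul, torusCoeff_torusChar,
      if_pos rfl] at h2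
    have h3 := pi_cube_ne_zero
    refine eq_inv_of_mul_eq_one_right (mul_right_cancel₀ h3 ?_)
    rw [one_mul, mul_assoc]
    exact h2.symm

theorem ae_eq_of_torusCoeff_eq {f g : Torus3 → ℂ} (hf : Integrable f) (hg : Integrable g)
    (h : ∀ n, torusCoeff f n = torusCoeff g n) : f =ᵐ[volume] g := by
  have h1 := ae_eq_zero_of_torusCoeff_eq_zero (f := fun x => f x - g x) (hf.sub hg) fun n => by
    rw [torusCoeff_sub hf hg, h n, sub_self]
  filter_upwards [h1] with x hx
  exact sub_eq_zero.mp hx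

end FundamentalSolution

/-! ### The Green function -/

section Green

/-- The Fourier coefficients of the smooth function which corrects the truncated Newtonian potential
to a multiple of the Green function. The one at `n = 0` makes the mean vanish. -/
noncomputable def correctorCoeff : (Fin 3 → ℤ) → ℂ :=
  Function.update (fun n => torusCoeff (torusLift fun v => ((parametrixError 0 v : ℝ) : ℂ)) n *
      ((torusEigenvalue n)⁻¹ * (8 * (Real.pi : ℂ) ^ 3)⁻¹)) 0
    (-torusCoeff (torusLift fun v => ((parametrix 0 v : ℝ) : ℂ)) 0 * (8 * (Real.pi : ℂ) ^ 3)⁻¹)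

theorem rapidDecay_correctorCoeff : RapidDecay correctorCoeff := by
  have hs := torusSmooth_torusLift_ofReal (fun _ => parametrixError_of_one_le)
    fun v => (contDiff_parametrixError le_rfl).contDiffAt
  refine RapidDecay.update (hs.rapidDecay.mul_bounded
    (B := 1 * ‖(8 * (Real.pi : ℂ) ^ 3)⁻¹‖) fun n => ?_) _ _
  rw [norm_mul]
  exact mul_le_mul_of_nonneg_right (norm_torusEigenvalue_inv_le n) (norm_nonneg _)

theorem conj_correctorCoeff (n : Fin 3 → ℤ) :
    (starRingEnd ℂ) (correctorCoeff n) = correctorCoeff (-n) := by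
  unfold correctorCoeff
  by_cases hn : n = 0
  · subst hn
    have h := torusCoeff_conj_of_real (torusLift (parametrix 0)) 0
    rw [neg_zero] at h ⊢
    simp only [Function.update_self, map_mul, map_neg, map_inv₀, map_pow, Complex.conj_ofReal,
      map_ofNat]
    exact congrArg (fun z => -z * (8 * (Real.pi : ℂ) ^ 3)⁻¹) h
  · have h := torusCoeff_conj_of_real (torusLift (parametrixError 0)) n
    rw [Function.update_of_ne hn, Function.update_of_ne (neg_ne_zero.mpr hn)]
    simp only [map_mul, map_inv₀, map_pow, Complex.conj_ofReal, map_ofNat, conj_torusEigenvalue,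
      torusEigenvalue_neg]
    exact congrArg (· * ((torusEigenvalue n)⁻¹ * (8 * (Real.pi : ℂ) ^ 3)⁻¹)) h

/-- The Green function of the torus: the truncated Newtonian potential plus a smooth corrector,
normalised. -/
noncomputable def torusGreen (x : Torus3) : ℝ :=
  (torusLift (parametrix 0) x + (torusSeries correctorCoeff x).re) / newtonMass

theorem ofReal_torusGreen (x : Torus3) : (torusGreen x : ℂ) = (newtonMass : ℂ)⁻¹ *
    (torusLift (fun v => ((parametrix 0 v : ℝ) : ℂ)) x + torusSeries correctorCoeff x) := by
  have h := Complex.conj_eq_iff_re.mp (torusSeries_conj conj_correctorCoeff x)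
  rw [torusGreen, div_eq_inv_mul]
  push_cast
  rw [h]
  rfl

theorem memLp_torusGreen_ofReal : MemLp (fun x => (torusGreen x : ℂ)) 2 volume := by
  rw [funext ofReal_torusGreen]
  have h := (continuous_torusSeries
    rapidDecay_correctorCoeff.summable_norm).memLp_of_hasCompactSupport (p := 2) (μ := volume)
    (HasCompactSupport.of_compactSpace _)
  exact (memLp_torusLift_parametrix.add h).const_mul _

/-- The corrector is chosen exactly so that the Green function has the coefficients `‖n‖⁻²`; for
`n = 0` this is the junk value `0⁻¹ = 0`. -/
theorem torusCoeff_torusGreen (n : Fin 3 → ℤ) :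
    torusCoeff (fun x => (torusGreen x : ℂ)) n = (torusEigenvalue n)⁻¹ := by
  have hm : (newtonMass : ℂ) ≠ 0 := Complex.ofReal_ne_zero.mpr newtonMass_pos.ne'
  have hπ := pi_cube_ne_zero
  have hs := rapidDecay_correctorCoeff.summable_norm
  rw [funext ofReal_torusGreen, torusCoeff_const_mul,
    torusCoeff_add (memLp_torusLift_parametrix.integrable one_le_two)
      (continuous_torusSeries hs).integrable_torus, torusCoeff_torusSeries hs, correctorCoeff]
  by_cases hn : n = 0
  · subst hn
    rw [Function.update_self, torusEigenvalue_eq_zero_iff.mpr rfl, inv_zero]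
    field_simp
    ring
  · have h1 := mt torusEigenvalue_eq_zero_iff.mp hn
    have h2 := torusEigenvalue_mul_torusCoeff_parametrix n
    rw [Function.update_of_ne hn]
    field_simp
    linear_combination h2

theorem torusSmoothAt_torusGreen {x : Torus3} (hx : x ≠ 0) : TorusSmoothAt torusGreen x := by
  have h1 : TorusSmoothAt (torusLift (parametrix 0)) x := by
    refine torusSmoothAt_torusLift (fun _ => parametrix_of_one_le) (contDiffAt_parametrix ?_)
    have := norm_pos_iff.mpr (mt torusRep_eq_zero.mp hx)
    positivity
  have h2 := rapidDecay_correctorCoeff.torusSmooth x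
  exact (ContDiffAt.add h1 (Complex.reCLM.contDiff.contDiffAt.comp _ h2)).div_const _

/-- Near `0` the Green function is a positive multiple of `1 / ‖v‖` plus a bounded function. -/
theorem tendsto_torusGreen : Tendsto torusGreen (𝓝[≠] 0) atTop := by
  have hrep : Tendsto torusRep (𝓝[≠] 0) (𝓝[≠] 0) := tendsto_nhdsWithin_iff.mpr
    ⟨torusRep_tendsto_zero.mono_left nhdsWithin_le_nhds, by
      filter_upwards [self_mem_nhdsWithin] with x hx using mt torusRep_eq_zero.mp hx⟩
  have hP : Tendsto (parametrix 0) (𝓝[≠] 0) atTop := by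
    refine (tendsto_inv_nhdsGT_zero.comp tendsto_norm_nhdsNE_zero).congr' ?_
    have h1 : IsOpen {w : EuclideanSpace ℝ (Fin 3) | ‖w‖ ^ 2 < 1 / 4} :=
      isOpen_lt (by fun_prop) continuous_const
    filter_upwards [mem_nhdsWithin_of_mem_nhds (h1.mem_nhds (by simp))] with v hv
    rw [parametrix, cutoff_of_le (le_of_lt hv), one_mul, add_zero, ← Real.rpow_natCast ‖v‖ 2,
      ← Real.rpow_mul (norm_nonneg v)]
    norm_num
    exact (Real.rpow_neg_one _).symm
  have hU : Tendsto (fun x => (torusSeries correctorCoeff x).re) (𝓝[≠] 0)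
      (𝓝 (torusSeries correctorCoeff 0).re) :=
    ((Complex.continuous_re.comp (continuous_torusSeries
      rapidDecay_correctorCoeff.summable_norm)).tendsto 0).mono_left nhdsWithin_le_nhds
  exact ((hP.comp hrep).atTop_add hU).atTop_div_const newtonMass_pos

theorem tendsto_insert_zero_map_subtype :
    Tendsto (fun s : Finset {n : Fin 3 → ℤ // n ≠ 0} =>
      insert 0 (s.map (Function.Embedding.subtype _))) atTop atTop := by
  refine tendsto_atTop.mpr fun b => ?_
  filter_upwards [eventually_ge_atTop (b.subtype fun n => n ≠ 0)] with s hs n hn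
  by_cases h : n = 0
  · simp [h]
  · refine Finset.mem_insert_of_mem (Finset.mem_map.mpr ⟨⟨n, h⟩, hs ?_, rfl⟩)
    simpa using hn

theorem torusGreenPartialSum_eq (s : Finset {n : Fin 3 → ℤ // n ≠ 0}) (x : Torus3) :
    torusGreenPartialSum s x = ∑ n ∈ insert 0 (s.map (Function.Embedding.subtype _)),
      torusCoeff (fun x => (torusGreen x : ℂ)) n / (8 * (Real.pi : ℂ) ^ 3) * torusChar n x := by
  rw [Finset.sum_insert (by simp), Finset.sum_map, torusGreenPartialSum, Finset.mul_sum]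
  simp only [torusCoeff_torusGreen]
  rw [torusEigenvalue_eq_zero_iff.mpr rfl, inv_zero, zero_div, zero_mul, zero_add]
  refine Finset.sum_congr rfl fun n _ => ?_
  rw [Function.Embedding.subtype_apply, torusEigenvalue]
  ring

theorem tendsto_torusGreenPartialSum :
    Tendsto (fun s : Finset {n : Fin 3 → ℤ // n ≠ 0} =>
      eLpNorm (fun x => (torusGreen x : ℂ) - torusGreenPartialSum s x) 2 volume) atTop (𝓝 0) := by
  simp only [torusGreenPartialSum_eq]
  exact (tendsto_torusSeries_of_memLp memLp_torusGreen_ofReal).comp tendsto_insert_zero_map_subtype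

/-- The Green function has no continuous modification, as it blows up at `0`; hence its Fourier
series is not absolutely convergent. -/
theorem not_summable_torusEigenvalue_inv : ¬ Summable fun n => ‖(torusEigenvalue n)⁻¹‖ := by
  intro hs
  have hs' : Summable fun n => ‖(torusEigenvalue n)⁻¹ / (8 * (Real.pi : ℂ) ^ 3)‖ := by
    simp only [norm_div]
    exact hs.div_const _
  set g := torusSeries fun n => (torusEigenvalue n)⁻¹ / (8 * (Real.pi : ℂ) ^ 3) with hg
  have hgc : Continuous g := continuous_torusSeries hs'
  have hae : (fun x => (torusGreen x : ℂ)) =ᵐ[volume] g :=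
    ae_eq_of_torusCoeff_eq (memLp_torusGreen_ofReal.integrable one_le_two) hgc.integrable_torus
      fun n => by
        rw [torusCoeff_torusGreen, hg, torusCoeff_torusSeries hs',
          mul_div_cancel₀ _ pi_cube_ne_zero]
  have h1 : ∀ᶠ x in 𝓝[≠] 0, ‖g 0‖ + 1 < torusGreen x :=
    tendsto_torusGreen.eventually_gt_atTop _
  have h2 : ∀ᶠ x in 𝓝 0, ‖g x‖ < ‖g 0‖ + 1 :=
    hgc.norm.continuousAt.eventually_lt_const (by linarith)
  obtain ⟨u, hu, huo, hu0⟩ := mem_nhds_iff.mp ((eventually_nhdsWithin_iff.mp h1).and h2)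
  have hd : Dense {x | (torusGreen x : ℂ) = g x ∧ torusRep x ≠ 0} :=
    Measure.dense_of_ae (hae.and ae_torusRep_ne_zero)
  -- a point near `0`, but not `0`, where the Green function takes its continuous value
  obtain ⟨x, hxu, hx, hx0⟩ := hd.inter_open_nonempty u huo ⟨0, hu0⟩
  obtain ⟨h3, h4⟩ := hu hxu
  have h5 := h3 (mt torusRep_eq_zero.mpr hx0)
  rw [← hx, Complex.norm_real] at h4
  exact (h5.trans_le (le_abs_self _)).not_gt h4

theorem torusGreenPartialSum_zero_re (s : Finset {n : Fin 3 → ℤ // n ≠ 0}) :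
    (torusGreenPartialSum s 0).re =
      ∑ n ∈ s, (8 * Real.pi ^ 3)⁻¹ * ‖(torusEigenvalue n.1)⁻¹‖ := by
  have h : ∀ n : Fin 3 → ℤ, torusEigenvalue n = ((‖torusEigenvalue n‖ : ℝ) : ℂ) := fun n => by
    rw [torusEigenvalue_eq_intCast, Complex.norm_intCast, ← Int.cast_abs,
      abs_of_nonneg (Finset.sum_nonneg fun i _ => sq_nonneg (n i))]
    push_cast
    rfl
  have h2 : torusGreenPartialSum s 0 =
      ((∑ n ∈ s, (8 * Real.pi ^ 3)⁻¹ * ‖(torusEigenvalue n.1)⁻¹‖ : ℝ) : ℂ) := by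
    rw [torusGreenPartialSum, Finset.mul_sum]
    push_cast
    refine Finset.sum_congr rfl fun n _ => ?_
    rw [norm_inv, Complex.ofReal_inv, ← h, torusChar_apply_zero, torusEigenvalue]
    ring
  rw [h2, Complex.ofReal_re]

theorem tendsto_torusGreenPartialSum_zero_re :
    Tendsto (fun s : Finset {n : Fin 3 → ℤ // n ≠ 0} => (torusGreenPartialSum s 0).re)
      atTop atTop := by
  simp only [torusGreenPartialSum_zero_re]
  have hmono : Monotone fun s : Finset {n : Fin 3 → ℤ // n ≠ 0} =>
      ∑ n ∈ s, (8 * Real.pi ^ 3)⁻¹ * ‖(torusEigenvalue n.1)⁻¹‖ := fun s t hst =>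
    Finset.sum_le_sum_of_subset_of_nonneg hst fun n _ _ => by positivity
  refine (tendsto_atTop_of_monotone hmono).resolve_right ?_
  rintro ⟨l, hl⟩
  have hs : Summable fun n : {n : Fin 3 → ℤ // n ≠ 0} =>
      (8 * Real.pi ^ 3)⁻¹ * ‖(torusEigenvalue n.1)⁻¹‖ := HasSum.summable (a := l) hl
  rw [summable_mul_left_iff (by positivity)] at hs
  refine not_summable_torusEigenvalue_inv ?_
  refine ((Function.Injective.summable_iff Subtype.val_injective fun n hn => ?_).mp hs)
  have : n = 0 := by
    by_contra h
    exact hn ⟨⟨n, h⟩, rfl⟩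
  simp [torusEigenvalue_eq_zero_iff.mpr this]

end Green

theorem mainTheorem8 :
    ∃ φ : Torus3 → ℝ,
      -- `φ` is the sum of the (unconditionally convergent) Fourier series in `L²(T³)`
      (MemLp φ 2 volume ∧
        Tendsto (fun s : Finset {n : Fin 3 → ℤ // n ≠ 0} =>
          eLpNorm (fun x => (φ x : ℂ) - torusGreenPartialSum s x) 2 volume) atTop (𝓝 0)) ∧
      -- `φ` is the fundamental solution of the Laplacian
      IsTorusFundamentalSolution (fun x => (φ x : ℂ)) ∧
      (∀ ψ : Torus3 → ℂ, IsTorusFundamentalSolution ψ → ψ =ᵐ[volume] fun x => (φ x : ℂ)) ∧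
      -- `φ` is smooth away from `0`
      (∀ x : Torus3, x ≠ 0 → TorusSmoothAt φ x) ∧
      -- `φ` becomes infinite at `0`: as a limit, and as the value of the series there
      Tendsto φ (𝓝[≠] 0) atTop ∧
      Tendsto (fun s : Finset {n : Fin 3 → ℤ // n ≠ 0} => (torusGreenPartialSum s 0).re)
        atTop atTop := by
  have hint := memLp_torusGreen_ofReal.integrable one_le_two
  refine ⟨torusGreen, ⟨memLp_torusGreen_ofReal.re, tendsto_torusGreenPartialSum⟩,
    isTorusFundamentalSolution_of_torusCoeff hint torusCoeff_torusGreen,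
    fun ψ hψ => ae_eq_of_torusCoeff_eq hψ.integrable hint fun n => ?_,
    fun x hx => torusSmoothAt_torusGreen hx, tendsto_torusGreen,
    tendsto_torusGreenPartialSum_zero_re⟩
  rw [hψ.torusCoeff_eq, torusCoeff_torusGreen]
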